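/- Let $l^1$ and $l^\infty$ be the complex Banach spaces of absolutely summable, respectively bounded, sequences, and identify $(l^1)^*$ with $l^\infty$ through the pairing $\langle x,y\rangle=\sum_n x_ny_n$. Let $T=S^*+W$, where $S$ is a bounded linear operator on $l^1$ and $W$ is a weakly compact operator on $l^\infty$ (that is, the image of the closed unit ball under $W$ is relatively weakly compact). For $x\in l^\infty$ let $J_T(x)$ be the set of all $y\in l^\infty$ for which there are a strictly increasing sequence $(k_n)$ of natural numbers and a sequence $x_n\to x$ in $l^\infty$ with $T^{k_n}x_n\to y$, and let $J_T^{mix}(x)$ be the set of all $y\in l^\infty$ for which there is a sequence $x_n\to x$ in $l^\infty$ with $T^nx_n\to y$. The operator $T$ is called $J$-class (respectively $J^{mix}$-class) if $J_T(x)=l^\infty$ (respectively $J_T^{mix}(x)=l^\infty$) for some $x\neq0$. Denote by $\sigma$ the spectrum, by $\sigma_p$ the set of eigenvalues, by $T^*$ the Banach space adjoint of $T$ on $(l^\infty)^*$, by $\mathbb D$ the open unit disc of $\mathbb C$, and for a bounded operator $R$ on a Banach space put $\kappa(R)=\inf\{\|Rx\|:\|x\|=1\}$ and $i(R)=\lim_{n\to\infty}\kappa(R^n)^{1/n}$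 (this limit always exists). Then the following are equivalent: (i) $T$ is $J^{mix}$-class; (ii) $T$ is $J$-class; (iii) $J_T(x)$ has non-empty interior for some $x\neq0$; (iv) $\sigma(T)\cap\partial\mathbb D\neq\emptyset$ and $\sigma_p(T^*)\cap\overline{\mathbb D}=\emptyset$; (v) $i(T^*)>1$ and $\overline{\mathbb D}\subseteq\sigma_p(T)$; (vi) $i(T^*)>1$ and $0\in\sigma_p(T)$. -/

import Mathlib

open Set Filter Topology
open scoped ENNReal

noncomputable section

/-- The complex Banach space of absolutely summable sequences. -/
abbrev SeqOne : Type := lp (fun _ : ℕ => ℂ) 1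

/-- The complex Banach space of bounded sequences with the supremum norm. -/
abbrev SeqInfty : Type := lp (fun _ : ℕ => ℂ) ∞

section General

variable {X Y : Type*} [NormedAddCommGroup X] [NormedSpace ℂ X]
  [NormedAddCommGroup Y] [NormedSpace ℂ Y]

/-- The set `J_T(x)`: all limits of `T ^ (k n) (x n)`, where `x n → x` and `k` is strictly
increasing. -/
def JSet (T : X →L[ℂ] X) (x : X) : Set X :=
  {y | ∃ (k : ℕ → ℕ) (u : ℕ → X), StrictMono k ∧ Tendsto u atTop (𝓝 x) ∧
    Tendsto (fun n => (T ^ k n) (u n)) atTop (𝓝 y)}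

/-- The set `J_T^mix(x)`: all limits of `T ^ n (x n)`, where `x n → x`. -/
def JMixSet (T : X →L[ℂ] X) (x : X) : Set X :=
  {y | ∃ u : ℕ → X, Tendsto u atTop (𝓝 x) ∧ Tendsto (fun n => (T ^ n) (u n)) atTop (𝓝 y)}

/-- `T` is `J`-class: `J_T(x)` is the whole space for some nonzero `x`. -/
def IsJClass (T : X →L[ℂ] X) : Prop := ∃ x : X, x ≠ 0 ∧ JSet T x = univ

/-- `T` is `J^mix`-class: `J_T^mix(x)` is the whole space for some nonzero `x`. -/
def IsJMixClass (T : X →L[ℂ] X) : Prop := ∃ x : X, x ≠ 0 ∧ JMixSet T x = univ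

/-- The point spectrum: the set of eigenvalues. -/
def pointSpectrum (T : X →L[ℂ] X) : Set ℂ :=
  {μ | Module.End.HasEigenvalue (T : X →ₗ[ℂ] X) μ}

/-- The Banach space adjoint `T* : X* → X*`, `T* φ = φ ∘ T`. -/
def dualOp (T : X →L[ℂ] X) : StrongDual ℂ X →L[ℂ] StrongDual ℂ X :=
  ContinuousLinearMap.precomp ℂ T

/-- `W` is weakly compact: it maps the closed unit ball to a set whose closure in the weak
topology is weakly compact. -/
def IsWeaklyCompactOp (W : X →L[ℂ] Y) : Prop :=
  IsCompact (closure (toWeakSpace ℂ Y '' (W '' Metric.closedBall 0 1)))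

/-- The injectivity modulus `κ(T) = inf {‖T x‖ : ‖x‖ = 1}`. -/
def injModulus (T : X →L[ℂ] X) : ℝ := sInf ((fun x => ‖T x‖) '' {x : X | ‖x‖ = 1})

/-- The number `i(T) = lim κ(T ^ n) ^ (1 / n)`; the limit always exists, see
`tendsto_injModulus_pow`. -/
def injRadius (T : X →L[ℂ] X) : ℝ :=
  limUnder atTop (fun n : ℕ => injModulus (T ^ n) ^ (1 / (n : ℝ)))

theorem injModulus_nonneg (T : X →L[ℂ] X) : 0 ≤ injModulus T := by
  apply Real.sInf_nonneg
  rintro _ ⟨x, -, rfl⟩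
  exact norm_nonneg _

theorem injModulus_le (T : X →L[ℂ] X) {x : X} (hx : ‖x‖ = 1) : injModulus T ≤ ‖T x‖ :=
  csInf_le ⟨0, by rintro _ ⟨x, -, rfl⟩; exact norm_nonneg _⟩ ⟨x, hx, rfl⟩

theorem injModulus_mul_norm_le (T : X →L[ℂ] X) (x : X) : injModulus T * ‖x‖ ≤ ‖T x‖ := by
  by_cases hx : x = 0
  · simp [hx]
  have h0 : 0 < ‖x‖ := norm_pos_iff.2 hx
  have h := injModulus_le T (x := ((‖x‖⁻¹ : ℝ) : ℂ) • x)
    (by rw [norm_smul, Complex.norm_real, norm_inv, norm_norm]; exact inv_mul_cancel₀ h0.ne')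
  rw [map_smul, norm_smul, Complex.norm_real, norm_inv, norm_norm] at h
  calc injModulus T * ‖x‖ ≤ (‖x‖⁻¹ * ‖T x‖) * ‖x‖ := by gcongr
    _ = ‖T x‖ := by field_simp

theorem injModulus_mul_le (S T : X →L[ℂ] X) :
    injModulus S * injModulus T ≤ injModulus (S * T) := by
  by_cases hne : ∃ x : X, ‖x‖ = 1
  · obtain ⟨x, hx⟩ := hne
    refine le_csInf ⟨_, x, hx, rfl⟩ ?_
    rintro _ ⟨z, hz, rfl⟩
    calc injModulus S * injModulus T ≤ injModulus S * ‖T z‖ :=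
          mul_le_mul_of_nonneg_left (injModulus_le T hz) (injModulus_nonneg S)
      _ ≤ ‖S (T z)‖ := injModulus_mul_norm_le S _
  · have he : {x : X | ‖x‖ = 1} = ∅ := by
      exact eq_empty_iff_forall_notMem.2 fun x h => hne ⟨x, h⟩
    simp [injModulus, he]

theorem injModulus_mul_le_norm_mul (S T : X →L[ℂ] X) :
    injModulus (S * T) ≤ ‖S‖ * injModulus T := by
  by_cases hne : ∃ x : X, ‖x‖ = 1
  · obtain ⟨x, hx⟩ := hne
    rcases (norm_nonneg S).eq_or_lt with h | h
    · calc injModulus (S * T) ≤ ‖S (T x)‖ := injModulus_le (S * T) hx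
        _ ≤ ‖S‖ * ‖T x‖ := S.le_opNorm _
        _ = ‖S‖ * injModulus T := by rw [← h]; simp
    · rw [← div_le_iff₀' h]
      refine le_csInf ⟨_, x, hx, rfl⟩ ?_
      rintro _ ⟨z, hz, rfl⟩
      rw [div_le_iff₀' h]
      exact (injModulus_le (S * T) hz).trans (S.le_opNorm _)
  · have he : {x : X | ‖x‖ = 1} = ∅ := by
      exact eq_empty_iff_forall_notMem.2 fun x h => hne ⟨x, h⟩
    simp [injModulus, he]

theorem injModulus_le_norm (T : X →L[ℂ] X) : injModulus T ≤ ‖T‖ := by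
  by_cases hne : ∃ x : X, ‖x‖ = 1
  · obtain ⟨x, hx⟩ := hne
    simpa [hx] using (injModulus_le T hx).trans (T.le_opNorm x)
  · have he : {x : X | ‖x‖ = 1} = ∅ := by
      exact eq_empty_iff_forall_notMem.2 fun x h => hne ⟨x, h⟩
    simp [injModulus, he]

/-- The limit defining `i(T)` exists. -/
theorem tendsto_injModulus_pow (T : X →L[ℂ] X) :
    Tendsto (fun n : ℕ => injModulus (T ^ n) ^ (1 / (n : ℝ))) atTop (𝓝 (injRadius T)) := by
  apply tendsto_nhds_limUnder
  by_cases h : ∃ m, injModulus (T ^ m) = 0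
  · obtain ⟨m, hm⟩ := h
    refine ⟨0, tendsto_const_nhds.congr' ?_⟩
    filter_upwards [eventually_ge_atTop m, eventually_ge_atTop 1] with n hn hn1
    have h1 : injModulus (T ^ n) = 0 := by
      refine le_antisymm ?_ (injModulus_nonneg _)
      have := injModulus_mul_le_norm_mul (T ^ (n - m)) (T ^ m)
      rwa [← pow_add, Nat.sub_add_cancel hn, hm, mul_zero] at this
    have h2 : (1 / (n : ℝ)) ≠ 0 := by positivity
    rw [h1, Real.zero_rpow h2]
  · push Not at h
    have hpos : ∀ n, 0 < injModulus (T ^ n) := fun n =>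
      lt_of_le_of_ne (injModulus_nonneg _) (h n).symm
    have hsub : Subadditive (fun n : ℕ => -Real.log (injModulus (T ^ n))) := by
      intro m n
      have h1 := Real.log_le_log (mul_pos (hpos m) (hpos n)) (injModulus_mul_le (T ^ m) (T ^ n))
      rw [Real.log_mul (h m) (h n), ← pow_add] at h1
      linarith
    have hT : 0 < ‖T‖ := by
      have := (hpos 1).trans_le (injModulus_le_norm (T ^ 1))
      rwa [pow_one] at this
    have hbdd : BddBelow (range fun n : ℕ => -Real.log (injModulus (T ^ n)) / n) := by
      refine ⟨min 0 (-Real.log ‖T‖), ?_⟩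
      rintro _ ⟨n, rfl⟩
      rcases Nat.eq_zero_or_pos n with rfl | hn
      · simp
      refine (min_le_right _ _).trans ?_
      have hn' : (0 : ℝ) < n := by exact_mod_cast hn
      have h1 := Real.log_le_log (hpos n)
        ((injModulus_le_norm (T ^ n)).trans (norm_pow_le' T hn))
      rw [Real.log_pow] at h1
      change _ ≤ -Real.log (injModulus (T ^ n)) / n
      rw [le_div_iff₀ hn']
      linarith
    refine ⟨Real.exp (-hsub.lim), ?_⟩
    refine ((Real.continuous_exp.tendsto _).comp (hsub.tendsto_lim hbdd).neg).congr ?_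
    intro n
    rw [Real.rpow_def_of_pos (hpos n)]
    simp only [Function.comp_apply]
    congr 1
    ring

end General

/-- `R` is the operator `S*` on the bounded sequences, where the dual of the space of absolutely
summable sequences is identified with the bounded sequences through the (bilinear) pairing
`⟨x, y⟩ = ∑ n, x n * y n`: it satisfies `⟨x, R y⟩ = ⟨S x, y⟩`. -/
def IsAdjointOp (S : SeqOne →L[ℂ] SeqOne) (R : SeqInfty →L[ℂ] SeqInfty) : Prop :=
  ∀ (x : SeqOne) (y : SeqInfty), ∑' n, x n * R y n = ∑' n, S x n * y n

/-- The set of operators `S* + W` on the bounded sequences, `S` an operator on the absolutely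
summable sequences, `W` weakly compact. -/
def adjointPlusWeaklyCompact : Set (SeqInfty →L[ℂ] SeqInfty) :=
  {T | ∃ (S : SeqOne →L[ℂ] SeqOne) (R W : SeqInfty →L[ℂ] SeqInfty),
    IsAdjointOp S R ∧ IsWeaklyCompactOp W ∧ T = R + W}

end

noncomputable section

/-! ### Lower bounds for powers and the radius `i(A)` -/

section InjectivityRadius

variable {X : Type*} [NormedAddCommGroup X] [NormedSpace ℂ X]

/-! Everything rests on a dichotomy for T = S* + W: each μ is either an eigenvalue of T*, or T* - μ
is bounded below. Since the class is stable under subtracting μ, it suffices that an injective T* is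
bounded below (`injModulus_dualOp_pos`). Suppose ‖φ_n‖ = 1 and T*φ_n → 0. Injectivity of T* means
that T has dense range, so φ_n is weak* null. On ℓ^∞ the adjoint of a weakly compact operator makes
bounded weak* null sequences norm null (`IsWeaklyCompactOp.tendsto_norm_comp`, the Grothendieck and
Dunford-Pettis properties combined), so W*φ_n → 0 and then S**φ_n → 0. But ‖S**φ‖ + ‖W*φ‖ ≥ c‖φ‖: on
ℓ^1 this comes from the Schur property (`exists_pos_mul_norm_le`), and weak* compactness carries it
to the whole dual (`mul_norm_le_norm_comp_add`).

The rest holds on any Banach space (`tfae_of_forall_injModulus_dualOp_pos`). If i(A) > 0, then A - μ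
is not bounded below for some |μ| = i(A) (`exists_injModulus_sub_smul_eq_zero`); hence i(T*) > 1 as
soon as T* has no eigenvalue in the closed disc. In that case, for some c > 1 and all large n, each
y has a preimage under T^n of norm at most 2c^(-n)‖y‖. Adding such preimages to a kernel vector x
gives J^mix(x) = X; conversely, if T were injective they would be the only preimages, and a nonempty
J(x) would force x = 0. An eigenfunctional of T* in the closed disc has constant modulus on J(x), so
it cannot coexist with interior points. Finally T - μ is onto throughout the closed disc, so the
eigenvalues of T there are relatively open and closed, and connectedness fills the disc. -/

theorem injModulus_le_add_norm_sub (A B : X →L[ℂ] X) :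
    injModulus A ≤ injModulus B + ‖A - B‖ := by
  by_cases hne : ∃ x : X, ‖x‖ = 1
  · obtain ⟨x, hx⟩ := hne
    rw [← sub_le_iff_le_add]
    refine le_csInf ⟨_, x, hx, rfl⟩ ?_
    rintro _ ⟨z, hz, rfl⟩
    have h1 : A z = B z + (A - B) z := by simp
    have h2 := injModulus_le A hz
    have h3 := (A - B).le_opNorm z
    rw [h1] at h2
    have h4 := norm_add_le (B z) ((A - B) z)
    simp only [mem_ofPred_eq] at hz
    rw [hz, mul_one] at h3
    simp only
    linarith
  · have he : {x : X | ‖x‖ = 1} = ∅ := eq_empty_iff_forall_notMem.2 fun x h => hne ⟨x, h⟩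
    simp [injModulus, he]

theorem continuous_injModulus_sub_smul (A : X →L[ℂ] X) :
    Continuous fun μ : ℂ => injModulus (A - μ • (1 : X →L[ℂ] X)) := by
  refine LipschitzWith.continuous (K := ‖(1 : X →L[ℂ] X)‖₊) (LipschitzWith.of_le_add_mul _ ?_)
  intro μ ν
  refine (injModulus_le_add_norm_sub _ (A - ν • (1 : X →L[ℂ] X))).trans ?_
  have : A - μ • (1 : X →L[ℂ] X) - (A - ν • (1 : X →L[ℂ] X)) = (ν - μ) • (1 : X →L[ℂ] X) := by
    rw [sub_smul]; abel
  rw [this, norm_smul, dist_comm, dist_eq_norm, mul_comm]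
  simp

theorem exists_pos_forall_le_injModulus {K : Set ℂ} (hK : IsCompact K) (A : X →L[ℂ] X)
    (h : ∀ μ ∈ K, 0 < injModulus (A - μ • (1 : X →L[ℂ] X))) :
    ∃ ε > 0, ∀ μ ∈ K, ε ≤ injModulus (A - μ • (1 : X →L[ℂ] X)) := by
  rcases K.eq_empty_or_nonempty with rfl | hne
  · exact ⟨1, one_pos, by simp⟩
  · obtain ⟨μ, hμ, hmin⟩ :=
      hK.exists_isMinOn hne (continuous_injModulus_sub_smul A).continuousOn
    exact ⟨_, h μ hμ, fun ν hν => hmin hν⟩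

/-- The coefficient of a^(j+k) is the sum of ζ^(i(j+k+1)) over i, which vanishes unless m divides
j+k+1. As 1 ≤ j+k+1 < 2m, only the m pairs with j+k = m-1 survive, each contributing m. -/
theorem sum_root_smul_sq_geom_sum {R : Type*} [Ring R] [Algebra ℂ R] {m : ℕ} (hm : 0 < m)
    {ζ : ℂ} (hζ : IsPrimitiveRoot ζ m) (a : R) :
    ∑ i ∈ Finset.range m, ζ ^ i • (∑ k ∈ Finset.range m, (ζ ^ i • a) ^ k) ^ 2 =
      ((m : ℂ) ^ 2) • a ^ (m - 1) := by
  have h1 : ∀ i ∈ Finset.range m, ζ ^ i • (∑ k ∈ Finset.range m, (ζ ^ i • a) ^ k) ^ 2 =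
      ∑ j ∈ Finset.range m, ∑ k ∈ Finset.range m, (ζ ^ (j + k + 1)) ^ i • a ^ (j + k) := by
    intro i _
    rw [sq, Finset.sum_mul_sum, Finset.smul_sum]
    refine Finset.sum_congr rfl fun j _ => ?_
    rw [Finset.smul_sum]
    refine Finset.sum_congr rfl fun k _ => ?_
    rw [← pow_add, smul_pow, smul_smul]
    congr 1
    ring
  rw [Finset.sum_congr rfl h1, Finset.sum_comm]
  have h2 : ∀ j ∈ Finset.range m, ∑ i ∈ Finset.range m, ∑ k ∈ Finset.range m,
      (ζ ^ (j + k + 1)) ^ i • a ^ (j + k) = (m : ℂ) • a ^ (m - 1) := by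
    intro j hj
    rw [Finset.mem_range] at hj
    rw [Finset.sum_comm, Finset.sum_eq_single (m - 1 - j)]
    · have e1 : j + (m - 1 - j) + 1 = m := by omega
      have e2 : j + (m - 1 - j) = m - 1 := by omega
      rw [e1, e2, hζ.pow_eq_one]
      simp [Nat.cast_smul_eq_nsmul]
    · intro k hk hne
      rw [Finset.mem_range] at hk
      have hne1 : ζ ^ (j + k + 1) ≠ 1 := by
        intro h
        obtain ⟨d, hd⟩ := (hζ.pow_eq_one_iff_dvd _).1 h
        have : d < 2 := by
          by_contra hcon
          have : m * 2 ≤ m * d := Nat.mul_le_mul_left _ (by omega)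
          omega
        interval_cases d <;> omega
      have : (ζ ^ (j + k + 1)) ^ m = 1 := by rw [← pow_mul, mul_comm, pow_mul, hζ.pow_eq_one, one_pow]
      rw [← Finset.sum_smul, geom_sum_eq hne1, this]
      simp
    · intro h
      exact absurd (Finset.mem_range.2 (by omega)) h
  rw [Finset.sum_congr rfl h2, Finset.sum_const, Finset.card_range, ← Nat.cast_smul_eq_nsmul ℂ,
    smul_smul, sq]

/-- With z an m-th root of unity, zA - 1 times the geometric sum is A^m - 1, so the lower bound
controls each squared sum by ε^(-2)‖(A^m - 1)²x‖. Squaring is what gains the factor m: m such terms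
add up to m²A^(m-1)x. -/
theorem norm_pow_apply_mul_le (A : X →L[ℂ] X) {ε : ℝ} (hε : 0 < ε)
    (h : ∀ μ : ℂ, ‖μ‖ = 1 → ε ≤ injModulus (A - μ • (1 : X →L[ℂ] X))) {m : ℕ} (hm : 0 < m) (x : X) :
    m * ‖(A ^ (m - 1)) x‖ ≤ (‖x‖ + 2 * ‖(A ^ m) x‖ + ‖(A ^ (2 * m)) x‖) / ε ^ 2 := by
  have hζ := Complex.isPrimitiveRoot_exp m hm.ne'
  set ζ := Complex.exp (2 * Real.pi * Complex.I / m)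
  have hnorm : ∀ i : ℕ, ‖ζ ^ i‖ = 1 := fun i => by
    rw [norm_pow, hζ.norm'_eq_one hm.ne', one_pow]
  set Q := (‖x‖ + 2 * ‖(A ^ m) x‖ + ‖(A ^ (2 * m)) x‖) / ε ^ 2
  have key : ∀ i : ℕ, ‖((∑ k ∈ Finset.range m, (ζ ^ i • A) ^ k) ^ 2) x‖ ≤ Q := by
    intro i
    set z := ζ ^ i
    have hz : ‖z‖ = 1 := hnorm i
    have hz0 : z ≠ 0 := by rw [← norm_ne_zero_iff, hz]; exact one_ne_zero
    have hlow : ∀ v : X, ε * ‖v‖ ≤ ‖(z • A - 1) v‖ := by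
      intro v
      have e : z • A - 1 = z • (A - z⁻¹ • (1 : X →L[ℂ] X)) := by
        rw [smul_sub, smul_smul, mul_inv_cancel₀ hz0, one_smul]
      rw [e, smul_apply, norm_smul, hz, one_mul]
      exact (mul_le_mul_of_nonneg_right (h _ (by rw [norm_inv, hz, inv_one])) (norm_nonneg v)).trans
        (injModulus_mul_norm_le _ _)
    have hzm : z ^ m = 1 := by
      rw [← pow_mul, mul_comm, pow_mul, hζ.pow_eq_one, one_pow]
    have e2 : (z • A - 1) ^ 2 * (∑ k ∈ Finset.range m, (z • A) ^ k) ^ 2 = (A ^ m - 1) ^ 2 := by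
      have hc : Commute (z • A - 1) (∑ k ∈ Finset.range m, (z • A) ^ k) := by
        rw [commute_iff_eq, mul_geom_sum, geom_sum_mul]
      rw [← hc.mul_pow, mul_geom_sum, smul_pow, hzm, one_smul]
    set P := (∑ k ∈ Finset.range m, (z • A) ^ k) ^ 2
    have e3 : ((A ^ m - 1) ^ 2 : X →L[ℂ] X) x = (A ^ (2 * m)) x - (2 : ℂ) • (A ^ m) x + x := by
      have : (A ^ m - 1) ^ 2 = A ^ (2 * m) - (2 : ℂ) • A ^ m + 1 := by
        rw [two_mul, pow_add, sq, mul_sub, sub_mul, two_smul]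
        simp only [mul_one, one_mul]
        abel
      rw [this]
      simp
    have e4 : ‖((A ^ m - 1) ^ 2 : X →L[ℂ] X) x‖ ≤ ‖x‖ + 2 * ‖(A ^ m) x‖ + ‖(A ^ (2 * m)) x‖ := by
      rw [e3]
      refine (norm_add_le _ _).trans ?_
      have := norm_sub_le ((A ^ (2 * m)) x) ((2 : ℂ) • (A ^ m) x)
      rw [norm_smul, Complex.norm_ofNat] at this
      linarith
    have e5 : ε * (ε * ‖P x‖) ≤ ‖((A ^ m - 1) ^ 2 : X →L[ℂ] X) x‖ := by
      rw [← e2, sq, mul_assoc]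
      exact (mul_le_mul_of_nonneg_left (hlow _) hε.le).trans (hlow _)
    rw [le_div_iff₀ (by positivity)]
    nlinarith
  have hsum := congrArg (fun B : X →L[ℂ] X => ‖B x‖) (sum_root_smul_sq_geom_sum hm hζ A)
  simp only [sum_apply, smul_apply] at hsum
  have hle : ‖((m : ℂ) ^ 2) • (A ^ (m - 1)) x‖ ≤ m * Q := by
    rw [← hsum]
    refine (norm_sum_le_of_le (f := fun i => ζ ^ i • ((∑ k ∈ Finset.range m, (ζ ^ i • A) ^ k) ^ 2) x)
      (n := fun _ => Q) _ fun i _ => ?_).trans ?_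
    · rw [norm_smul, hnorm, one_mul]
      exact key i
    · simp
  rw [norm_smul, norm_pow, Complex.norm_natCast, sq, mul_assoc] at hle
  exact le_of_mul_le_mul_left hle (by exact_mod_cast hm)

theorem exists_norm_pow_le_quarter (A : X →L[ℂ] X) {ε : ℝ} (hε : 0 < ε)
    (h : ∀ μ : ℂ, ‖μ‖ = 1 → ε ≤ injModulus (A - μ • (1 : X →L[ℂ] X))) :
    ∃ m : ℕ, 0 < m ∧ ∀ x, ‖(A ^ m) x‖ ≤ (‖x‖ + ‖(A ^ (2 * m)) x‖) / 4 := by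
  obtain ⟨m, hm⟩ := exists_nat_gt (6 * ‖A‖ / ε ^ 2)
  have hm0 : 0 < m := by
    have : (0 : ℝ) < m := lt_of_le_of_lt (by positivity) hm
    exact_mod_cast this
  refine ⟨m, hm0, fun x => ?_⟩
  have h1 := norm_pow_apply_mul_le A hε h hm0 x
  have h2 : ‖(A ^ m) x‖ ≤ ‖A‖ * ‖(A ^ (m - 1)) x‖ := by
    have : A ^ m = A * A ^ (m - 1) := by rw [← pow_succ', Nat.sub_add_cancel hm0]
    rw [this]
    exact A.le_opNorm _
  set Q := ‖x‖ + 2 * ‖(A ^ m) x‖ + ‖(A ^ (2 * m)) x‖ with hQ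
  have hm' : (0 : ℝ) < m := by exact_mod_cast hm0
  have hQ0 : 0 ≤ Q := by positivity
  have h3 : m * ‖(A ^ m) x‖ ≤ ‖A‖ * (Q / ε ^ 2) := by
    calc m * ‖(A ^ m) x‖ ≤ m * (‖A‖ * ‖(A ^ (m - 1)) x‖) := by gcongr
      _ = ‖A‖ * (m * ‖(A ^ (m - 1)) x‖) := by ring
      _ ≤ _ := by gcongr
  have h4 : m * (6 * ‖(A ^ m) x‖) ≤ m * Q := by
    calc m * (6 * ‖(A ^ m) x‖) = 6 * (m * ‖(A ^ m) x‖) := by ring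
      _ ≤ 6 * (‖A‖ * (Q / ε ^ 2)) := by gcongr
      _ = (6 * ‖A‖ / ε ^ 2) * Q := by ring
      _ ≤ _ := by gcongr
  have h5 := le_of_mul_le_mul_left h4 hm'
  linarith

/-- A discrete maximum principle. The barrier 2^(-j) c 0 + 2^(-(2M-j)) c (2M) dominates c at both
ends of [0, 2M] and is a supersolution of the recursion, so the difference has no positive maximum
inside. -/
theorem le_of_three_term_inequality {c : ℕ → ℝ} (h0 : ∀ j, 0 ≤ c j)
    (h : ∀ j, c (j + 1) ≤ (c j + c (j + 2)) / 4) (M : ℕ) :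
    c M ≤ (1 / 2) ^ M * (c 0 + c (2 * M)) := by
  set g : ℕ → ℝ := fun j => c j - (1 / 2) ^ j * c 0 - (1 / 2) ^ (2 * M - j) * c (2 * M) with hg
  obtain ⟨j, hj, hmax⟩ := Finset.exists_max_image (Finset.range (2 * M + 1)) g ⟨0, by simp⟩
  rw [Finset.mem_range] at hj
  have hgj : g j ≤ 0 := by
    rcases Nat.eq_zero_or_pos j with rfl | hj0
    · have : 0 ≤ (1 / 2 : ℝ) ^ (2 * M) * c (2 * M) := mul_nonneg (by positivity) (h0 _)
      simp only [hg, pow_zero, one_mul, Nat.sub_zero]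
      linarith
    rcases Nat.lt_or_ge j (2 * M) with hj1 | hj1
    · obtain ⟨i, rfl⟩ : ∃ i, j = i + 1 := ⟨j - 1, by omega⟩
      have h1 := hmax i (Finset.mem_range.2 (by omega))
      have h2 := hmax (i + 2) (Finset.mem_range.2 (by omega))
      have h3 := h i
      obtain ⟨d, hd⟩ : ∃ d, 2 * M = i + 2 + d := ⟨2 * M - (i + 2), by omega⟩
      simp only [hg] at h1 h2 ⊢
      have e1 : 2 * M - i = d + 2 := by omega
      have e2 : 2 * M - (i + 1) = d + 1 := by omega
      have e3 : 2 * M - (i + 2) = d := by omega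
      rw [e1, e2] at h1
      rw [e2, e3] at h2
      rw [e2]
      have p1 : 0 ≤ (1 / 2 : ℝ) ^ i * c 0 := mul_nonneg (by positivity) (h0 _)
      have p2 : 0 ≤ (1 / 2 : ℝ) ^ d * c (2 * M) := mul_nonneg (by positivity) (h0 _)
      simp only [pow_succ] at h1 h2 ⊢
      nlinarith
    · obtain rfl : j = 2 * M := by omega
      have : 0 ≤ (1 / 2 : ℝ) ^ (2 * M) * c 0 := mul_nonneg (by positivity) (h0 _)
      simp only [hg, Nat.sub_self, pow_zero, one_mul]
      linarith
  have hM := (hmax M (Finset.mem_range.2 (by omega))).trans hgj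
  simp only [hg] at hM
  have : 2 * M - M = M := by omega
  rw [this] at hM
  linarith

/-- The three-term estimate is applied along the orbit of one unit vector. The left side is bounded
below by the modulus for every vector, so the infimum may be taken on the right alone. -/
theorem injModulus_pow_le_of_forall_norm_pow_le {A : X →L[ℂ] X} {m : ℕ}
    (hA : ∀ x, ‖(A ^ m) x‖ ≤ (‖x‖ + ‖(A ^ (2 * m)) x‖) / 4) (M : ℕ) :
    injModulus (A ^ (m * M)) ≤ (1 / 2) ^ M * (1 + injModulus (A ^ (m * (2 * M)))) := by
  by_cases hne : ∃ x : X, ‖x‖ = 1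
  · obtain ⟨x, hx⟩ := hne
    rw [← div_le_iff₀' (by positivity), ← sub_le_iff_le_add']
    refine le_csInf ⟨_, x, hx, rfl⟩ ?_
    rintro _ ⟨z, hz, rfl⟩
    rw [sub_le_iff_le_add', div_le_iff₀' (by positivity)]
    refine (injModulus_le _ hz).trans ?_
    have := le_of_three_term_inequality (c := fun j => ‖(A ^ (m * j)) z‖)
      (fun _ => norm_nonneg _) (fun j => ?_) M
    · simpa [show ‖z‖ = 1 from hz] using this
    · have h1 := hA ((A ^ (m * j)) z)
      simp only [← mul_apply_eq_comp, ← pow_add] at h1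
      convert h1 using 4
      · ring
      · congr 2; ring
  · have he : {x : X | ‖x‖ = 1} = ∅ := eq_empty_iff_forall_notMem.2 fun x h => hne ⟨x, h⟩
    simp [injModulus, he]

theorem injModulus_smul (c : ℂ) (A : X →L[ℂ] X) : injModulus (c • A) = ‖c‖ * injModulus A := by
  unfold injModulus
  rw [← smul_eq_mul, ← Real.sInf_smul_of_nonneg (norm_nonneg c), ← image_smul, image_image]
  simp [norm_smul]

theorem pow_le_injModulus_pow (A : X →L[ℂ] X) {n : ℕ} (hn : 0 < n) :
    injModulus A ^ n ≤ injModulus (A ^ n) := by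
  induction n, hn using Nat.le_induction with
  | base => simp
  | succ n hn ih =>
    rw [pow_succ, pow_succ]
    exact (mul_le_mul_of_nonneg_right ih (injModulus_nonneg A)).trans (injModulus_mul_le _ _)

theorem eventually_pow_le_injModulus_pow {A : X →L[ℂ] X} {c : ℝ} (hc : 0 ≤ c)
    (h : c < injRadius A) : ∀ᶠ n : ℕ in atTop, c ^ n ≤ injModulus (A ^ n) := by
  filter_upwards [(tendsto_injModulus_pow A).eventually_const_lt h, eventually_gt_atTop 0]
    with n hn hn0
  have := pow_le_pow_left₀ hc hn.le n
  rwa [one_div, Real.rpow_inv_natCast_pow (injModulus_nonneg _) hn0.ne'] at this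

theorem le_injRadius_of_frequently {A : X →L[ℂ] X} {s : ℝ} (hs : 0 ≤ s)
    (h : ∃ᶠ n : ℕ in atTop, s ^ n ≤ injModulus (A ^ n)) : s ≤ injRadius A := by
  refine ge_of_tendsto_of_frequently (tendsto_injModulus_pow A) ?_
  refine (h.and_eventually (eventually_gt_atTop 0)).mono fun n ⟨hn, hn0⟩ => ?_
  have := Real.rpow_le_rpow (by positivity) hn (by positivity : 0 ≤ 1 / (n : ℝ))
  rw [one_div, Real.pow_rpow_inv_natCast hs hn0.ne'] at this
  rwa [one_div]

/-- As in Fekete's lemma: supermultiplicativity propagates the bound at n to all multiples of n, and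
infinitely many indices suffice because the limit exists. -/
theorem injModulus_pow_le_injRadius_pow (A : X →L[ℂ] X) {n : ℕ} (hn : 0 < n) :
    injModulus (A ^ n) ≤ injRadius A ^ n := by
  set s := injModulus (A ^ n) ^ ((n : ℝ)⁻¹) with hs
  have hs0 : 0 ≤ s := Real.rpow_nonneg (injModulus_nonneg _) _
  have hsn : s ^ n = injModulus (A ^ n) := Real.rpow_inv_natCast_pow (injModulus_nonneg _) hn.ne'
  rw [← hsn]
  refine pow_le_pow_left₀ hs0 (le_injRadius_of_frequently hs0 ?_) n
  rw [frequently_atTop]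
  intro N
  refine ⟨n * (N + 1), by nlinarith, ?_⟩
  rw [pow_mul, hsn, pow_mul]
  exact pow_le_injModulus_pow _ (Nat.succ_pos _)

theorem injModulus_le_injRadius (A : X →L[ℂ] X) : injModulus A ≤ injRadius A := by
  simpa using injModulus_pow_le_injRadius_pow A one_pos

/-- If `i(A) > 0`, then `A - μ` fails to be bounded below for some `μ` with `|μ| = i(A)`. -/
theorem exists_injModulus_sub_smul_eq_zero {A : X →L[ℂ] X} (hA : 0 < injRadius A) :
    ∃ μ : ℂ, ‖μ‖ = injRadius A ∧ injModulus (A - μ • (1 : X →L[ℂ] X)) = 0 := by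
  set r := injRadius A with hr
  by_contra! hcon
  obtain ⟨ε, hε, hlow⟩ := exists_pos_forall_le_injModulus (isCompact_sphere (0 : ℂ) r) A
    fun μ hμ => lt_of_le_of_ne (injModulus_nonneg _) (hcon μ (by simpa using hμ)).symm
  set B : X →L[ℂ] X := ((r⁻¹ : ℝ) : ℂ) • A with hB
  have hpow : ∀ n, injModulus (B ^ n) = r⁻¹ ^ n * injModulus (A ^ n) := fun n => by
    rw [hB, smul_pow, injModulus_smul, norm_pow, Complex.norm_real, norm_inv, Real.norm_of_nonneg hA.le]
  have hB1 : ∀ n, 0 < n → injModulus (B ^ n) ≤ 1 := fun n hn => by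
    rw [hpow, inv_pow, inv_mul_le_one₀ (by positivity)]
    exact injModulus_pow_le_injRadius_pow A hn
  obtain ⟨m, hm, hquarter⟩ := exists_norm_pow_le_quarter B (ε := ε / r) (by positivity) (by
    intro μ hμ
    have e : B - μ • (1 : X →L[ℂ] X) = ((r⁻¹ : ℝ) : ℂ) • (A - ((r : ℂ) * μ) • (1 : X →L[ℂ] X)) := by
      rw [hB, smul_sub, smul_smul, ← mul_assoc, ← Complex.ofReal_mul, inv_mul_cancel₀ hA.ne']
      simp
    rw [e, injModulus_smul, Complex.norm_real, norm_inv, Real.norm_of_nonneg hA.le, div_eq_inv_mul]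
    gcongr
    exact hlow _ (by simp [hμ, abs_of_pos hA]))
  -- Any value of t^m strictly between 1/2 and 1 works: t < 1 gives κ(B^(mM)) ≥ (3/4)^M for large M,
  -- while the three-term estimate gives at most 2 · (1/2)^M.
  set t : ℝ := (3 / 4) ^ ((m : ℝ)⁻¹) with ht
  have ht0 : 0 ≤ t := by positivity
  have htm : t ^ m = 3 / 4 := Real.rpow_inv_natCast_pow (by norm_num) hm.ne'
  have ht1 : t < 1 := by
    by_contra! hcon
    have := one_le_pow₀ hcon (n := m)
    rw [htm] at this
    norm_num at this
  have hev := eventually_pow_le_injModulus_pow (A := A) (c := r * t) (by positivity)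
    (by nlinarith)
  have hmul : Tendsto (fun M : ℕ => m * M) atTop atTop :=
    tendsto_id.const_mul_atTop' hm
  have hlarge : ∀ᶠ M : ℕ in atTop, 2 < (3 / 2 : ℝ) ^ M :=
    (tendsto_pow_atTop_atTop_of_one_lt (by norm_num)).eventually_gt_atTop 2
  obtain ⟨M, ⟨hM, hM2⟩, hM0⟩ := ((hmul.eventually hev).and hlarge |>.and (eventually_gt_atTop 0)).exists
  have h1 := injModulus_pow_le_of_forall_norm_pow_le hquarter M
  have h2 := hB1 (m * (2 * M)) (by positivity)
  have h3 : (3 / 4 : ℝ) ^ M ≤ injModulus (B ^ (m * M)) := by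
    rw [hpow, inv_pow, ← div_eq_inv_mul, le_div_iff₀ (by positivity), ← htm, ← pow_mul, mul_comm,
      ← mul_pow]
    exact hM
  have h4 : (3 / 4 : ℝ) ^ M ≤ (1 / 2) ^ M * 2 :=
    h3.trans (h1.trans (by gcongr; linarith))
  have h5 : (3 / 2 : ℝ) ^ M * (1 / 2) ^ M = (3 / 4) ^ M := by rw [← mul_pow]; norm_num
  have h6 : (0 : ℝ) < (1 / 2) ^ M := by positivity
  nlinarith

/-- Some power has κ(A^n) > 1 ≥ |μ^n|, so A^n - μ^n is bounded below, and it factors through A - μ.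
-/
theorem injModulus_sub_smul_pos {A : X →L[ℂ] X} (hA : 1 < injRadius A) {μ : ℂ} (hμ : ‖μ‖ ≤ 1) :
    0 < injModulus (A - μ • (1 : X →L[ℂ] X)) := by
  obtain ⟨c, hc1, hc⟩ := exists_between hA
  obtain ⟨n, hn⟩ := (eventually_pow_le_injModulus_pow (by linarith) hc |>.and
    (eventually_gt_atTop 0)).exists
  have h1 : 1 < injModulus (A ^ n) := (one_lt_pow₀ hc1 hn.2.ne').trans_le hn.1
  have hcomm : Commute A (μ • (1 : X →L[ℂ] X)) := (Commute.one_right A).smul_right μ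
  have h2 := hcomm.geom_sum₂_mul n
  set P := ∑ i ∈ Finset.range n, A ^ i * (μ • (1 : X →L[ℂ] X)) ^ (n - 1 - i)
  have h3 := injModulus_le_add_norm_sub (A ^ n) (A ^ n - (μ • (1 : X →L[ℂ] X)) ^ n)
  have h4 : ‖A ^ n - (A ^ n - (μ • (1 : X →L[ℂ] X)) ^ n)‖ ≤ 1 := by
    rw [sub_sub_cancel, smul_pow, one_pow, norm_smul, norm_pow]
    exact mul_le_one₀ (pow_le_one₀ (norm_nonneg _) hμ) (norm_nonneg _) ContinuousLinearMap.norm_id_le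
  rw [← h2] at h3 h4
  have h5 := injModulus_mul_le_norm_mul P (A - μ • (1 : X →L[ℂ] X))
  by_contra hcon
  have h6 : injModulus (A - μ • (1 : X →L[ℂ] X)) = 0 :=
    le_antisymm (not_lt.1 hcon) (injModulus_nonneg _)
  rw [h6, mul_zero] at h5
  linarith

end InjectivityRadius

/-! ### Surjectivity and eigenvalues from lower bounds on the adjoint -/

section Duality

variable {X : Type*} [NormedAddCommGroup X] [NormedSpace ℂ X]

theorem dualOp_apply (T : X →L[ℂ] X) (φ : StrongDual ℂ X) (x : X) : dualOp T φ x = φ (T x) := rfl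

theorem dualOp_sub_smul (T : X →L[ℂ] X) (μ : ℂ) :
    dualOp (T - μ • (1 : X →L[ℂ] X)) = dualOp T - μ • (1 : StrongDual ℂ X →L[ℂ] StrongDual ℂ X) := by
  refine ContinuousLinearMap.ext fun φ => ContinuousLinearMap.ext fun x => ?_
  change φ (T x - μ • x) = φ (T x) - μ • φ x
  rw [map_sub, map_smul]

set_option synthInstance.maxHeartbeats 200000 in
theorem dualOp_pow (T : X →L[ℂ] X) (n : ℕ) : dualOp (T ^ n) = dualOp T ^ n := by
  induction n with
  | zero => rfl
  | succ n ih =>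
    rw [pow_succ, pow_succ', ← ih]
    rfl

theorem mem_pointSpectrum_iff {T : X →L[ℂ] X} {μ : ℂ} :
    μ ∈ pointSpectrum T ↔ ∃ x, x ≠ 0 ∧ T x = μ • x := by
  constructor
  · intro h
    obtain ⟨x, hx⟩ := Module.End.HasEigenvalue.exists_hasEigenvector h
    exact ⟨x, hx.2, hx.apply_eq_smul⟩
  · rintro ⟨x, hx, h⟩
    exact Module.End.hasEigenvalue_of_hasEigenvector
      (x := x) (Module.End.hasEigenvector_iff.2 ⟨Module.End.mem_eigenspace_iff.2 h, hx⟩)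

theorem pointSpectrum_subset_spectrum (T : X →L[ℂ] X) : pointSpectrum T ⊆ spectrum ℂ T := by
  intro μ hμ
  obtain ⟨x, hx, h⟩ := mem_pointSpectrum_iff.1 hμ
  rw [spectrum.mem_iff]
  rintro ⟨u, hu⟩
  apply hx
  have h1 : (u : X →L[ℂ] X) x = 0 := by
    rw [hu, Algebra.algebraMap_eq_smul_one]
    simp [h]
  calc x = ((↑u⁻¹ * ↑u : X →L[ℂ] X)) x := by rw [u.inv_mul]; rfl
    _ = (↑u⁻¹ : X →L[ℂ] X) ((u : X →L[ℂ] X) x) := rfl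
    _ = 0 := by rw [h1, map_zero]

theorem notMem_pointSpectrum_of_injModulus_pos {T : X →L[ℂ] X} {μ : ℂ}
    (h : 0 < injModulus (T - μ • (1 : X →L[ℂ] X))) : μ ∉ pointSpectrum T := by
  intro hμ
  obtain ⟨x, hx, hTx⟩ := mem_pointSpectrum_iff.1 hμ
  have h1 := injModulus_mul_norm_le (T - μ • (1 : X →L[ℂ] X)) x
  simp only [sub_apply, smul_apply, one_apply_eq_self, hTx, sub_self, norm_zero] at h1
  exact absurd h1 (not_le.2 (mul_pos h (norm_pos_iff.2 hx)))

/-- If `T*` is bounded below by `c`, then the image of the unit ball under `T` is dense in the ball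
of radius `c`. -/
theorem mem_closure_image_closedBall {T : X →L[ℂ] X} {y : X} (hy : ‖y‖ ≤ injModulus (dualOp T)) :
    y ∈ closure (T '' Metric.closedBall 0 1) := by
  by_contra hcon
  have hconv : Convex ℝ (closure (T '' Metric.closedBall (0 : X) 1)) :=
    ((convex_closedBall (0 : X) 1).is_linear_image
      ((T.restrictScalars ℝ : X →L[ℝ] X) : X →ₗ[ℝ] X).isLinear).closure
  obtain ⟨f, u, hfu, hfy⟩ := RCLike.geometric_hahn_banach_closed_point (𝕜 := ℂ) hconv
    isClosed_closure hcon
  have hu : 0 < u := by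
    simpa using hfu 0 (subset_closure ⟨0, by simp, map_zero T⟩)
  have hle : ‖dualOp T f‖ ≤ u := by
    refine ContinuousLinearMap.opNorm_le_of_unit_norm (𝕜 := ℂ) hu.le fun x hx => ?_
    obtain ⟨c, hc, hcx⟩ := RCLike.exists_norm_eq_mul_self (K := ℂ) (dualOp T f x)
    have h1 : (f (T (c • x))) = ((‖dualOp T f x‖ : ℝ) : ℂ) := by
      rw [map_smul, map_smul, smul_eq_mul]
      exact hcx.symm
    have := hfu (T (c • x)) (subset_closure ⟨c • x, by simp [norm_smul, hc, hx], rfl⟩)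
    rw [h1] at this
    simpa using this.le
  have h1 := injModulus_mul_norm_le (dualOp T) f
  have h2 : RCLike.re (f y) ≤ ‖f‖ * ‖y‖ := (RCLike.re_le_norm _).trans (f.le_opNorm y)
  have h3 : ‖f‖ * ‖y‖ ≤ ‖f‖ * injModulus (dualOp T) := by gcongr
  nlinarith

/-- If `T*` is bounded below by `c > 0`, then `T` is onto, with control of the preimages. -/
theorem exists_preimage_norm_le_of_dualOp [CompleteSpace X] {T : X →L[ℂ] X} {c : ℝ} (hc : 0 < c)
    (hT : c ≤ injModulus (dualOp T)) (y : X) : ∃ x, T x = y ∧ ‖x‖ ≤ 2 / c * ‖y‖ := by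
  -- Approximate solutions with half the error are iterated. The corrections form a geometric series
  -- of sum 2, which is the 2 in 2 / c.
  have step : ∀ y : X, ∃ x, ‖x‖ ≤ 1 / c * ‖y‖ ∧ ‖y - T x‖ ≤ 1 / 2 * ‖y‖ := by
    intro y
    rcases eq_or_ne y 0 with rfl | hy
    · exact ⟨0, by simp, by simp⟩
    have hy0 : 0 < ‖y‖ := norm_pos_iff.2 hy
    set s : ℝ := c / ‖y‖
    have hs : 0 < s := div_pos hc hy0
    have hmem : ((s : ℂ) • y) ∈ closure (T '' Metric.closedBall 0 1) := by
      apply mem_closure_image_closedBall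
      rw [norm_smul, Complex.norm_real, Real.norm_of_nonneg hs.le, div_mul_cancel₀ _ hy0.ne']
      exact hT
    obtain ⟨_, ⟨z, hz, rfl⟩, hd⟩ := Metric.mem_closure_iff.1 hmem (c / 2) (by positivity)
    have hsC : (s : ℂ) ≠ 0 := by exact_mod_cast hs.ne'
    have hsinv : ‖((s : ℂ))⁻¹‖ = ‖y‖ / c := by
      rw [norm_inv, Complex.norm_real, Real.norm_of_nonneg hs.le, inv_div]
    refine ⟨(s : ℂ)⁻¹ • z, ?_, ?_⟩
    · rw [norm_smul, hsinv, one_div, inv_mul_eq_div]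
      have hz1 : ‖z‖ ≤ 1 := by simpa using hz
      exact mul_le_of_le_one_right (by positivity) hz1
    · have e : y - T ((s : ℂ)⁻¹ • z) = (s : ℂ)⁻¹ • ((s : ℂ) • y - T z) := by
        rw [smul_sub, smul_smul, inv_mul_cancel₀ hsC, one_smul, map_smul]
      rw [e, norm_smul, hsinv, ← dist_eq_norm]
      calc ‖y‖ / c * dist ((s : ℂ) • y) (T z) ≤ ‖y‖ / c * (c / 2) := by gcongr
        _ = 1 / 2 * ‖y‖ := by field_simp
  choose g hg1 hg2 using step
  set r : ℕ → X := fun n => (fun y => y - T (g y))^[n] y with hr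
  have hrs : ∀ n, r (n + 1) = r n - T (g (r n)) := fun n => Function.iterate_succ_apply' _ _ _
  have hrn : ∀ n, ‖r n‖ ≤ (1 / 2) ^ n * ‖y‖ := by
    intro n
    induction n with
    | zero => simp [hr]
    | succ n ih =>
      rw [hrs, pow_succ', mul_assoc]
      exact (hg2 _).trans (by gcongr)
  have hgn : ∀ n, ‖g (r n)‖ ≤ (1 / c * ‖y‖) * (1 / 2) ^ n := fun n =>
    (hg1 _).trans (by
      calc 1 / c * ‖r n‖ ≤ 1 / c * ((1 / 2) ^ n * ‖y‖) := by gcongr; exact hrn n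
        _ = _ := by ring)
  have hsumb : HasSum (fun n : ℕ => (1 / c * ‖y‖) * (1 / 2 : ℝ) ^ n) ((1 / c * ‖y‖) * 2) :=
    hasSum_geometric_two.mul_left _
  have hsum : Summable fun n => g (r n) := Summable.of_norm_bounded hsumb.summable hgn
  refine ⟨∑' n, g (r n), ?_, ?_⟩
  · have h1 : Tendsto (fun n => ∑ k ∈ Finset.range n, T (g (r k))) atTop (𝓝 (T (∑' n, g (r n)))) :=
      (T.hasSum hsum.hasSum).tendsto_sum_nat
    have h2 : ∀ n, ∑ k ∈ Finset.range n, T (g (r k)) = y - r n := by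
      intro n
      induction n with
      | zero => simp [hr]
      | succ n ih => rw [Finset.sum_range_succ, ih, hrs]; abel
    have h3 : Tendsto r atTop (𝓝 0) := by
      refine squeeze_zero_norm hrn ?_
      have := (tendsto_pow_atTop_nhds_zero_of_lt_one (r := (1 / 2 : ℝ)) (by norm_num)
        (by norm_num)).mul_const ‖y‖
      simpa using this
    refine tendsto_nhds_unique h1 ?_
    simp only [h2]
    simpa using tendsto_const_nhds.sub h3
  · refine (tsum_of_norm_bounded hsumb hgn).trans_eq ?_
    ring

theorem surjective_of_injModulus_dualOp_pos [CompleteSpace X] {T : X →L[ℂ] X}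
    (hT : 0 < injModulus (dualOp T)) : Function.Surjective T := fun y =>
  let ⟨x, hx, _⟩ := exists_preimage_norm_le_of_dualOp hT le_rfl y
  ⟨x, hx⟩

/-- An eigenvector x for μ is perturbed: for ν near μ, solve (T - ν)u = (μ - ν)x with ‖u‖ < ‖x‖;
then x - u is a nonzero eigenvector for ν. -/
theorem pointSpectrum_mem_nhds [CompleteSpace X] {T : X →L[ℂ] X} {μ : ℂ}
    (hT : 0 < injModulus (dualOp T - μ • (1 : StrongDual ℂ X →L[ℂ] StrongDual ℂ X)))
    (hμ : μ ∈ pointSpectrum T) : pointSpectrum T ∈ 𝓝 μ := by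
  obtain ⟨x, hx, hTx⟩ := mem_pointSpectrum_iff.1 hμ
  obtain ⟨c, hc0, hc⟩ := exists_between hT
  have h1 : ∀ᶠ ν in 𝓝 μ, c < injModulus (dualOp T - ν • (1 : StrongDual ℂ X →L[ℂ] StrongDual ℂ X)) :=
    (continuous_injModulus_sub_smul (dualOp T)).continuousAt.eventually_const_lt hc
  have h2 : ∀ᶠ ν in 𝓝 μ, ‖μ - ν‖ < c / 2 := by
    have : Tendsto (fun ν => ‖μ - ν‖) (𝓝 μ) (𝓝 ‖μ - μ‖) := by
      apply Continuous.tendsto; fun_prop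
    rw [sub_self, norm_zero] at this
    exact this.eventually_lt_const (by positivity)
  filter_upwards [h1, h2] with ν hν1 hν2
  rw [← dualOp_sub_smul] at hν1
  obtain ⟨u, hu, hun⟩ := exists_preimage_norm_le_of_dualOp hc0 hν1.le ((μ - ν) • x)
  refine mem_pointSpectrum_iff.2 ⟨x - u, ?_, ?_⟩
  · intro h
    rw [sub_eq_zero] at h
    rw [← h, norm_smul] at hun
    have hx0 : 0 < ‖x‖ := norm_pos_iff.2 hx
    have : 2 / c * (‖μ - ν‖ * ‖x‖) < ‖x‖ := by
      calc 2 / c * (‖μ - ν‖ * ‖x‖) < 2 / c * (c / 2 * ‖x‖) := by gcongr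
        _ = ‖x‖ := by field_simp
    linarith
  · simp only [sub_apply, smul_apply, one_apply_eq_self, sub_smul] at hu
    rw [sub_eq_iff_eq_add] at hu
    rw [map_sub, hTx, hu, smul_sub]
    abel

/-- In the closed disc T - μ is onto, so spectral points are eigenvalues, and these persist under
small changes of μ. The interior of the point spectrum and the resolvent set are then disjoint open
sets covering a connected disc. -/
theorem closedBall_subset_pointSpectrum [CompleteSpace X] {T : X →L[ℂ] X}
    (hT : ∀ μ : ℂ, ‖μ‖ ≤ 1 →
      0 < injModulus (dualOp T - μ • (1 : StrongDual ℂ X →L[ℂ] StrongDual ℂ X)))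
    (h : (spectrum ℂ T ∩ Metric.closedBall 0 1).Nonempty) :
    Metric.closedBall (0 : ℂ) 1 ⊆ pointSpectrum T := by
  have hpre : IsPreconnected (Metric.closedBall (0 : ℂ) 1) :=
    (convex_closedBall (0 : ℂ) 1).isPreconnected
  have hsub : ∀ μ ∈ Metric.closedBall (0 : ℂ) 1, μ ∈ spectrum ℂ T → μ ∈ pointSpectrum T := by
    intro μ hμ hs
    have hμ' : ‖μ‖ ≤ 1 := by simpa using hμ
    by_contra hcon
    refine spectrum.mem_iff.1 hs ?_
    have hunit : IsUnit (T - μ • (1 : X →L[ℂ] X)) := by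
      rw [ContinuousLinearMap.isUnit_iff_bijective]
      refine ⟨(injective_iff_map_eq_zero _).2 fun x hx => ?_, ?_⟩
      · by_contra hx0
        refine hcon (mem_pointSpectrum_iff.2 ⟨x, hx0, ?_⟩)
        simpa [sub_eq_zero] using hx
      · refine surjective_of_injModulus_dualOp_pos ?_
        rw [dualOp_sub_smul]
        exact hT μ hμ'
    rw [Algebra.algebraMap_eq_smul_one, ← neg_sub]
    exact hunit.neg
  have hnhds : ∀ μ ∈ Metric.closedBall (0 : ℂ) 1, μ ∈ spectrum ℂ T →
      μ ∈ interior (pointSpectrum T) := fun μ hμ hs =>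
    mem_interior_iff_mem_nhds.2 (pointSpectrum_mem_nhds (hT μ (by simpa using hμ)) (hsub μ hμ hs))
  refine (hpre.subset_left_of_subset_union isOpen_interior (spectrum.isOpen_resolventSet T) ?_ ?_
    ?_).trans interior_subset
  · exact Set.disjoint_left.2 fun μ hμ hr =>
      pointSpectrum_subset_spectrum T (interior_subset hμ) hr
  · intro μ hμ
    by_cases hs : μ ∈ spectrum ℂ T
    · exact Or.inl (hnhds μ hμ hs)
    · exact Or.inr (by simpa [spectrum] using hs)
  · obtain ⟨μ, hs, hμ⟩ := h
    exact ⟨μ, hμ, hnhds μ hμ hs⟩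

end Duality

/-! ### J-sets and the equivalences on a general Banach space -/

section JSets

variable {X : Type*} [NormedAddCommGroup X] [NormedSpace ℂ X]

theorem JMixSet_subset_JSet (T : X →L[ℂ] X) (x : X) : JMixSet T x ⊆ JSet T x :=
  fun _ ⟨u, hu, hy⟩ => ⟨id, u, strictMono_id, hu, hy⟩

/-- Since φ(T^k u) = μ^k φ(u), the constant is 0 when |μ| < 1 and |φ(x)| when |μ| = 1. -/
theorem norm_apply_eq_of_mem_JSet {T : X →L[ℂ] X} {φ : StrongDual ℂ X} {μ : ℂ} (hμ : ‖μ‖ ≤ 1)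
    (hφ : dualOp T φ = μ • φ) (x : X) : ∃ a : ℝ, ∀ y ∈ JSet T x, ‖φ y‖ = a := by
  have hpow : ∀ (n : ℕ) (z : X), φ ((T ^ n) z) = μ ^ n * φ z := by
    intro n
    induction n with
    | zero => intro z; simp
    | succ n ih =>
      intro z
      have : φ (T z) = μ * φ z := congrArg (fun ψ : StrongDual ℂ X => ψ z) hφ
      rw [pow_succ, mul_apply_eq_comp, ih, this]
      ring
  have hlim : ∀ y ∈ JSet T x, ∃ (k : ℕ → ℕ) (u : ℕ → X), StrictMono k ∧
      Tendsto u atTop (𝓝 x) ∧ Tendsto (fun n => ‖μ‖ ^ k n * ‖φ (u n)‖) atTop (𝓝 ‖φ y‖) := by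
    rintro y ⟨k, u, hk, hu, hy⟩
    refine ⟨k, u, hk, hu, ?_⟩
    refine ((φ.continuous.tendsto y).comp hy).norm.congr fun n => ?_
    rw [Function.comp_apply, hpow, norm_mul, norm_pow]
  rcases hμ.lt_or_eq with h | h
  · refine ⟨0, fun y hy => ?_⟩
    obtain ⟨k, u, hk, hu, hy⟩ := hlim y hy
    refine tendsto_nhds_unique hy ?_
    have h1 := (tendsto_pow_atTop_nhds_zero_of_lt_one (norm_nonneg μ) h).comp hk.tendsto_atTop
    simpa using h1.mul (((φ.continuous.tendsto x).comp hu).norm)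
  · refine ⟨‖φ x‖, fun y hy => ?_⟩
    obtain ⟨k, u, hk, hu, hy⟩ := hlim y hy
    refine tendsto_nhds_unique hy ?_
    simpa [h, Function.comp_def] using ((φ.continuous.tendsto x).comp hu).norm

theorem pointSpectrum_dualOp_inter_closedBall_eq_empty {T : X →L[ℂ] X} {x : X}
    (h : (interior (JSet T x)).Nonempty) :
    pointSpectrum (dualOp T) ∩ Metric.closedBall (0 : ℂ) 1 = ∅ := by
  refine eq_empty_iff_forall_notMem.2 ?_
  rintro μ ⟨hμ, hμ1⟩
  obtain ⟨φ, hφ0, hφ⟩ := mem_pointSpectrum_iff.1 hμ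
  obtain ⟨a, ha⟩ := norm_apply_eq_of_mem_JSet (by simpa using hμ1) hφ x
  obtain ⟨y, hy⟩ := h
  apply hφ0
  ext v
  have hev : ∀ᶠ t : ℝ in 𝓝 0, y + (t : ℂ) • v ∈ JSet T x ∧ y - (t : ℂ) • v ∈ JSet T x := by
    have h1 : Tendsto (fun t : ℝ => y + (t : ℂ) • v) (𝓝 0) (𝓝 y) := by
      have : Continuous (fun t : ℝ => y + (t : ℂ) • v) := by fun_prop
      simpa using this.tendsto 0
    have h2 : Tendsto (fun t : ℝ => y - (t : ℂ) • v) (𝓝 0) (𝓝 y) := by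
      have : Continuous (fun t : ℝ => y - (t : ℂ) • v) := by fun_prop
      simpa using this.tendsto 0
    have hn := mem_interior_iff_mem_nhds.1 hy
    exact (h1.eventually hn).and (h2.eventually hn)
  obtain ⟨t, ⟨ht1, ht2⟩, ht⟩ := ((hev.filter_mono nhdsWithin_le_nhds).and
    (self_mem_nhdsWithin : Ioi (0 : ℝ) ∈ 𝓝[>] 0)).exists
  have e1 := ha _ ht1
  have e2 := ha _ ht2
  have e0 := ha _ (interior_subset hy)
  -- The values of φ at y and y ± tv have equal modulus, so the parallelogram law forces φ(tv) = 0.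
  have hpar := parallelogram_law_with_norm ℝ (φ y) (φ ((t : ℂ) • v))
  rw [← map_add, ← map_sub, e1, e2, e0, map_smul, norm_smul, Complex.norm_real] at hpar
  have hmul : ‖t‖ * ‖φ v‖ = 0 := by nlinarith
  exact norm_eq_zero.1 ((mul_eq_zero.1 hmul).resolve_left (norm_ne_zero_iff.2 (ne_of_gt ht)))

theorem zero_mem_pointSpectrum_of_JSet [CompleteSpace X] {T : X →L[ℂ] X}
    (hT : 1 < injRadius (dualOp T)) {x : X} (hx : x ≠ 0) (h : (JSet T x).Nonempty) :
    (0 : ℂ) ∈ pointSpectrum T := by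
  by_contra hcon
  have hinj : ∀ z, T z = 0 → z = 0 := fun z hz => by
    by_contra hz0
    exact hcon (mem_pointSpectrum_iff.2 ⟨z, hz0, by simpa using hz⟩)
  have hinjn : ∀ n z, (T ^ n) z = 0 → z = 0 := by
    intro n
    induction n with
    | zero => intro z hz; simpa using hz
    | succ n ih =>
      intro z hz
      rw [pow_succ, mul_apply_eq_comp] at hz
      exact hinj _ (ih _ hz)
  obtain ⟨y, k, u, hk, hu, hy⟩ := h
  obtain ⟨c, hc1, hc⟩ := exists_between hT
  have hc0 : 0 < c := one_pos.trans hc1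
  have hbound : ∀ᶠ n in atTop, ‖u n‖ ≤ 2 / c ^ k n * ‖(T ^ k n) (u n)‖ := by
    filter_upwards [hk.tendsto_atTop.eventually (eventually_pow_le_injModulus_pow hc0.le hc)]
      with n hn
    rw [← dualOp_pow] at hn
    obtain ⟨v, hv, hvn⟩ := exists_preimage_norm_le_of_dualOp (pow_pos hc0 _) hn ((T ^ k n) (u n))
    have : v = u n := by
      -- Injectivity identifies the small preimage with u n itself, so u n → 0.
      rw [← sub_eq_zero]
      exact hinjn (k n) _ (by rw [map_sub, hv, sub_self])
    rwa [this] at hvn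
  refine hx (tendsto_nhds_unique hu (squeeze_zero_norm' hbound ?_))
  have h1 : Tendsto (fun n => 2 / c ^ k n) atTop (𝓝 0) :=
    ((tendsto_pow_atTop_atTop_of_one_lt hc1).comp hk.tendsto_atTop).const_div_atTop 2
  simpa using h1.mul hy.norm

theorem isJMixClass_of_one_lt_injRadius [CompleteSpace X] {T : X →L[ℂ] X}
    (hT : 1 < injRadius (dualOp T)) (h : (0 : ℂ) ∈ pointSpectrum T) : IsJMixClass T := by
  obtain ⟨x, hx, hTx⟩ := mem_pointSpectrum_iff.1 h
  rw [zero_smul] at hTx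
  refine ⟨x, hx, eq_univ_of_forall fun y => ?_⟩
  obtain ⟨c, hc1, hc⟩ := exists_between hT
  have hc0 : 0 < c := one_pos.trans hc1
  -- The lower bound can fail only for finitely many n, where v = 0 is a harmless default.
  have hex : ∀ n, ∃ v, c ^ n ≤ injModulus (dualOp T ^ n) → (T ^ n) v = y ∧ ‖v‖ ≤ 2 / c ^ n * ‖y‖ := by
    intro n
    by_cases hn : c ^ n ≤ injModulus (dualOp T ^ n)
    · obtain ⟨v, hv⟩ := exists_preimage_norm_le_of_dualOp (pow_pos hc0 n)
        (by rwa [dualOp_pow]) y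
      exact ⟨v, fun _ => hv⟩
    · exact ⟨0, fun h => absurd h hn⟩
  choose v hv using hex
  have hev := eventually_pow_le_injModulus_pow hc0.le hc
  refine ⟨fun n => x + v n, ?_, ?_⟩
  · have : Tendsto v atTop (𝓝 0) := by
      refine squeeze_zero_norm' (hev.mono fun n hn => (hv n hn).2) ?_
      have h1 : Tendsto (fun n => 2 / c ^ n) atTop (𝓝 0) :=
        (tendsto_pow_atTop_atTop_of_one_lt hc1).const_div_atTop 2
      simpa using h1.mul_const ‖y‖
    simpa using this.const_add x
  · refine tendsto_const_nhds.congr' ?_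
    filter_upwards [hev, eventually_gt_atTop 0] with n hn hn0
    obtain ⟨m, rfl⟩ := Nat.exists_eq_succ_of_ne_zero hn0.ne'
    have : (T ^ m.succ) x = 0 := by rw [pow_succ, mul_apply_eq_comp, hTx, map_zero]
    rw [map_add, this, zero_add, (hv _ hn).1]

/-- The equivalences hold for every operator on a Banach space for which absence of eigenvalues
of `T*` in the closed disc forces `i(T*) > 1`. -/
theorem tfae_of_forall_injModulus_dualOp_pos [CompleteSpace X] (T : X →L[ℂ] X)
    (hT : ∀ μ : ℂ, μ ∉ pointSpectrum (dualOp T) →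
      0 < injModulus (dualOp T - μ • (1 : StrongDual ℂ X →L[ℂ] StrongDual ℂ X))) :
    List.TFAE [
      IsJMixClass T,
      IsJClass T,
      ∃ x : X, x ≠ 0 ∧ (interior (JSet T x)).Nonempty,
      (spectrum ℂ T ∩ Metric.sphere (0 : ℂ) 1).Nonempty ∧
        pointSpectrum (dualOp T) ∩ Metric.closedBall (0 : ℂ) 1 = ∅,
      1 < injRadius (dualOp T) ∧ Metric.closedBall (0 : ℂ) 1 ⊆ pointSpectrum T,
      1 < injRadius (dualOp T) ∧ (0 : ℂ) ∈ pointSpectrum T] := by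
  have hpos : pointSpectrum (dualOp T) ∩ Metric.closedBall (0 : ℂ) 1 = ∅ → ∀ μ : ℂ, ‖μ‖ ≤ 1 →
      0 < injModulus (dualOp T - μ • (1 : StrongDual ℂ X →L[ℂ] StrongDual ℂ X)) :=
    fun h μ hμ => hT μ fun hmem =>
      eq_empty_iff_forall_notMem.1 h μ ⟨hmem, by simpa using hμ⟩
  have hrad : pointSpectrum (dualOp T) ∩ Metric.closedBall (0 : ℂ) 1 = ∅ →
      1 < injRadius (dualOp T) := by
    intro h
    -- The point μ = 0 makes T* itself bounded below, hence i(T*) > 0, as the spectral radius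
    -- argument requires.
    have h0 := hpos h 0 (by simp)
    rw [← dualOp_sub_smul, zero_smul, sub_zero] at h0
    by_contra hcon
    obtain ⟨μ, hμ, hμ0⟩ := exists_injModulus_sub_smul_eq_zero
      (h0.trans_le (injModulus_le_injRadius _))
    exact (hpos h μ (hμ.trans_le (not_lt.1 hcon))).ne' hμ0
  tfae_have 1 → 2
  | ⟨x, hx, h⟩ => ⟨x, hx, eq_univ_of_univ_subset (h.symm.trans_subset (JMixSet_subset_JSet T x))⟩
  tfae_have 2 → 3
  | ⟨x, hx, h⟩ => ⟨x, hx, by rw [h, interior_univ]; exact ⟨x, mem_univ x⟩⟩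
  tfae_have 3 → 6
  | ⟨x, hx, h⟩ =>
    have h1 := hrad (pointSpectrum_dualOp_inter_closedBall_eq_empty h)
    ⟨h1, zero_mem_pointSpectrum_of_JSet h1 hx (h.mono interior_subset)⟩
  tfae_have 6 → 1
  | ⟨h1, h2⟩ => isJMixClass_of_one_lt_injRadius h1 h2
  tfae_have 6 → 5
  | ⟨h1, h2⟩ => ⟨h1, closedBall_subset_pointSpectrum (fun μ hμ => injModulus_sub_smul_pos h1 hμ)
      ⟨0, pointSpectrum_subset_spectrum T h2, by simp⟩⟩
  tfae_have 5 → 6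
  | ⟨h1, h2⟩ => ⟨h1, h2 (by simp)⟩
  tfae_have 5 → 4
  | ⟨h1, h2⟩ => ⟨⟨1, pointSpectrum_subset_spectrum T (h2 (by simp)), by simp⟩,
      eq_empty_iff_forall_notMem.2 fun μ ⟨hμ, hμ1⟩ => notMem_pointSpectrum_of_injModulus_pos
        (injModulus_sub_smul_pos h1 (by simpa using hμ1)) hμ⟩
  tfae_have 4 → 5
  | ⟨h1, h2⟩ => ⟨hrad h2, closedBall_subset_pointSpectrum (hpos h2)
      (h1.mono (inter_subset_inter_right _ Metric.sphere_subset_closedBall))⟩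
  tfae_finish

end JSets

/-! ### Functionals on ℓ^∞ and their variation on sets of indices -/

section Cut

/-- Multiplication of a bounded sequence by the indicator function of a set. -/
def cut (A : Set ℕ) : SeqInfty →L[ℂ] SeqInfty :=
  LinearMap.mkContinuous
    { toFun := fun x => ⟨A.indicator x, memℓp_infty ⟨‖x‖, by
        rintro _ ⟨s, rfl⟩
        exact (norm_indicator_le_norm_self _ _).trans (lp.norm_apply_le_norm (by simp) x s)⟩⟩
      map_add' := fun x y => by
        ext s
        exact congrFun (indicator_add A x y) s
      map_smul' := fun c x => by
        ext s
        exact congrFun (indicator_const_smul A c x) s } 1 fun x => by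
    rw [one_mul]
    exact lp.norm_le_of_forall_le (norm_nonneg x) fun s =>
      (norm_indicator_le_norm_self _ _).trans (lp.norm_apply_le_norm (by simp) x s)

theorem cut_apply (A : Set ℕ) (x : SeqInfty) (s : ℕ) : cut A x s = A.indicator x s := rfl

theorem norm_cut_le (A : Set ℕ) : ‖cut A‖ ≤ 1 := LinearMap.mkContinuous_norm_le _ zero_le_one _

theorem cut_empty : cut ∅ = 0 := by
  ext x s
  simp [cut_apply]

theorem cut_cut (A B : Set ℕ) (x : SeqInfty) : cut A (cut B x) = cut (A ∩ B) x := by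
  ext s
  exact congrFun (indicator_indicator A B x) s

theorem cut_union {A B : Set ℕ} (h : Disjoint A B) (x : SeqInfty) :
    cut (A ∪ B) x = cut A x + cut B x := by
  ext s
  exact congrFun (indicator_union_of_disjoint h x) s

theorem cut_add_cut_compl (A : Set ℕ) (x : SeqInfty) : cut A x + cut Aᶜ x = x := by
  ext s
  exact congrFun (indicator_self_add_compl A x) s

theorem cut_biUnion {ι : Type*} (s : Finset ι) {D : ι → Set ℕ} (hD : Pairwise (Function.onFun Disjoint D))
    (x : SeqInfty) : cut (⋃ i ∈ s, D i) x = ∑ i ∈ s, cut (D i) x := by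
  classical
  induction s using Finset.induction_on with
  | empty => simp [cut_empty]
  | insert i s hi ih =>
    rw [Finset.set_biUnion_insert, Finset.sum_insert hi, ← ih, cut_union]
    rw [disjoint_iUnion₂_right]
    intro j hj
    exact hD fun h => hi (h ▸ hj)

theorem exists_glue {D : ℕ → Set ℕ} (hD : Pairwise (Function.onFun Disjoint D)) {z : ℕ → SeqInfty} {C : ℝ}
    (hz : ∀ k, ‖z k‖ ≤ C) : ∃ y : SeqInfty, ∀ k, cut (D k) y = cut (D k) (z k) := by
  classical
  refine ⟨⟨fun s => if h : ∃ k, s ∈ D k then z h.choose s else 0, memℓp_infty ⟨C, ?_⟩⟩, fun k => ?_⟩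
  · rintro _ ⟨s, rfl⟩
    dsimp only
    split_ifs with h
    · exact (lp.norm_apply_le_norm (by simp) _ s).trans (hz _)
    · rw [norm_zero]
      exact (norm_nonneg _).trans (hz 0)
  · ext s
    rw [cut_apply, cut_apply]
    by_cases hs : s ∈ D k
    · have h : ∃ k, s ∈ D k := ⟨k, hs⟩
      have hk : h.choose = k := by
        by_contra hne
        exact disjoint_left.1 (hD hne) h.choose_spec hs
      rw [indicator_of_mem hs, indicator_of_mem hs]
      change (if h : ∃ k, s ∈ D k then z h.choose s else 0) = _
      rw [dif_pos h, hk]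
    · rw [indicator_of_notMem hs, indicator_of_notMem hs]

/-- The variation of a functional on the bounded sequences over a set. -/
def variationOn (φ : StrongDual ℂ SeqInfty) (A : Set ℕ) : ℝ := ‖φ.comp (cut A)‖

theorem variationOn_nonneg (φ : StrongDual ℂ SeqInfty) (A : Set ℕ) : 0 ≤ variationOn φ A :=
  norm_nonneg _

theorem variationOn_empty (φ : StrongDual ℂ SeqInfty) : variationOn φ ∅ = 0 := by
  simp [variationOn, cut_empty]

theorem variationOn_le_norm (φ : StrongDual ℂ SeqInfty) (A : Set ℕ) : variationOn φ A ≤ ‖φ‖ :=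
  (φ.opNorm_comp_le _).trans (mul_le_of_le_one_right (norm_nonneg _) (norm_cut_le A))

theorem norm_apply_cut_le (φ : StrongDual ℂ SeqInfty) (A : Set ℕ) (x : SeqInfty) :
    ‖φ (cut A x)‖ ≤ variationOn φ A * ‖x‖ := (φ.comp (cut A)).le_opNorm x

theorem variationOn_mono (φ : StrongDual ℂ SeqInfty) {A B : Set ℕ} (h : A ⊆ B) :
    variationOn φ A ≤ variationOn φ B := by
  have : φ.comp (cut A) = (φ.comp (cut B)).comp (cut A) := by
    ext x
    simp [cut_cut, inter_eq_right.2 h]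
  unfold variationOn
  rw [this]
  exact ((φ.comp (cut B)).opNorm_comp_le _).trans
    (mul_le_of_le_one_right (norm_nonneg _) (norm_cut_le A))

theorem variationOn_union_le (φ : StrongDual ℂ SeqInfty) (A B : Set ℕ) :
    variationOn φ (A ∪ B) ≤ variationOn φ A + variationOn φ B := by
  have : φ.comp (cut (A ∪ B)) = φ.comp (cut A) + φ.comp (cut (B \ A)) := by
    refine ContinuousLinearMap.ext fun x => ?_
    change φ (cut (A ∪ B) x) = φ (cut A x) + φ (cut (B \ A) x)
    rw [← union_sdiff_self, cut_union disjoint_sdiff_right, map_add]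
  have h := variationOn_mono φ (sdiff_subset : B \ A ⊆ B)
  unfold variationOn at *
  rw [this]
  exact (norm_add_le _ _).trans (by gcongr)

/-- In the supremum norm, pieces of unit vectors on disjoint sets glue to a vector of norm at most
1, and rotating their phases makes the two values of φ add up. -/
theorem variationOn_add_le (φ : StrongDual ℂ SeqInfty) {A B : Set ℕ} (h : Disjoint A B) :
    variationOn φ A + variationOn φ B ≤ variationOn φ (A ∪ B) := by
  have key : ∀ x y : SeqInfty, ‖x‖ = 1 → ‖y‖ = 1 →
      ‖φ (cut A x)‖ + ‖φ (cut B y)‖ ≤ variationOn φ (A ∪ B) := by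
    intro x y hx hy
    obtain ⟨c, hc, hcx⟩ := RCLike.exists_norm_eq_mul_self (K := ℂ) (φ (cut A x))
    obtain ⟨d, hd, hdy⟩ := RCLike.exists_norm_eq_mul_self (K := ℂ) (φ (cut B y))
    have hz : ‖cut A (c • x) + cut B (d • y)‖ ≤ 1 := by
      refine lp.norm_le_of_forall_le zero_le_one fun s => ?_
      have hxs := lp.norm_apply_le_norm (by simp) x s
      have hys := lp.norm_apply_le_norm (by simp) y s
      rw [lp.coeFn_add, Pi.add_apply, cut_apply, cut_apply]
      by_cases hA : s ∈ A
      · rw [indicator_of_mem hA, indicator_of_notMem (disjoint_left.1 h hA), add_zero,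
          lp.coeFn_smul, Pi.smul_apply, norm_smul, hc, one_mul]
        linarith
      · rw [indicator_of_notMem hA, zero_add]
        refine (norm_indicator_le_norm_self _ _).trans ?_
        rw [lp.coeFn_smul, Pi.smul_apply, norm_smul, hd, one_mul]
        linarith
    have hcut : cut (A ∪ B) (cut A (c • x) + cut B (d • y)) = cut A (c • x) + cut B (d • y) := by
      rw [map_add, cut_cut, cut_cut, union_inter_cancel_left, union_inter_cancel_right]
    have h1 := norm_apply_cut_le φ (A ∪ B) (cut A (c • x) + cut B (d • y))
    replace h1 := h1.trans (mul_le_of_le_one_right (variationOn_nonneg _ _) hz)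
    rwa [hcut, map_add, map_smul, map_smul, map_smul, map_smul, smul_eq_mul, smul_eq_mul, ← hcx,
      ← hdy, ← RCLike.ofReal_add, RCLike.norm_ofReal, abs_of_nonneg (by positivity)] at h1
  rw [← le_sub_iff_add_le]
  refine ContinuousLinearMap.opNorm_le_of_unit_norm (𝕜 := ℂ)
    (sub_nonneg.2 (variationOn_mono φ subset_union_right)) fun x hx => ?_
  rw [le_sub_comm]
  refine ContinuousLinearMap.opNorm_le_of_unit_norm (𝕜 := ℂ) ?_ fun y hy => ?_
  · refine sub_nonneg.2 ?_
    have := norm_apply_cut_le φ A x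
    rw [hx, mul_one] at this
    exact this.trans (variationOn_mono φ subset_union_left)
  · have := key x y hx hy
    simp only [ContinuousLinearMap.comp_apply]
    linarith

theorem sum_variationOn_le (φ : StrongDual ℂ SeqInfty) {ι : Type*} (s : Finset ι) {D : ι → Set ℕ}
    (hD : Pairwise (Function.onFun Disjoint D)) : ∑ i ∈ s, variationOn φ (D i) ≤ ‖φ‖ := by
  classical
  refine le_trans ?_ (variationOn_le_norm φ (⋃ i ∈ s, D i))
  induction s using Finset.induction_on with
  | empty => simpa using variationOn_nonneg _ _
  | insert i s hi ih =>
    rw [Finset.set_biUnion_insert, Finset.sum_insert hi]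
    refine (add_le_add_right ih _).trans (variationOn_add_le φ ?_)
    rw [disjoint_iUnion₂_right]
    intro j hj
    exact hD fun h => hi (h ▸ hj)

end Cut

/-! ### Extraction principles for sets of indices -/

section Combinatorics

theorem le_sum_of_subadditive {p : Set ℕ → ℝ} (hempty : p ∅ = 0)
    (hsub : ∀ A B, p (A ∪ B) ≤ p A + p B) {ι : Type*} (s : Finset ι) (B : ι → Set ℕ) :
    p (⋃ i ∈ s, B i) ≤ ∑ i ∈ s, p (B i) := by
  classical
  induction s using Finset.induction_on with
  | empty => simp [hempty]
  | insert i s hi ih =>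
    rw [Finset.set_biUnion_insert, Finset.sum_insert hi]
    exact (hsub _ _).trans (by gcongr)

theorem exists_tendsto_of_ultrafilter {ι : Type*} (U : Ultrafilter ι) {f : ι → ℝ} {C : ℝ}
    (h0 : ∀ i, 0 ≤ f i) (hC : ∀ i, f i ≤ C) : ∃ l, Tendsto f U (𝓝 l) := by
  obtain ⟨l, -, hl⟩ := (isCompact_Icc (a := (0 : ℝ)) (b := C)).ultrafilter_le_nhds (U.map f)
    (le_principal_iff.2 (mem_map.2 (univ_mem' fun i => ⟨h0 i, hC i⟩)))
  exact ⟨l, hl⟩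

/-- A sequence of sets on which a bounded finitely additive set function is bounded away from `0`
has a subsequence with the finite intersection property. -/
theorem exists_strictMono_antitone_subset {U : Ultrafilter ℕ} (hU : (U : Filter ℕ) ≤ atTop)
    {p : Set ℕ → ℝ} {C : ℝ} (hmono : ∀ A B, A ⊆ B → p A ≤ p B) (hempty : p ∅ = 0)
    (hsub : ∀ A B, p (A ∪ B) ≤ p A + p B)
    (hsum : ∀ (s : Finset ℕ) (D : ℕ → Set ℕ), Pairwise (Function.onFun Disjoint D) →
      ∑ i ∈ s, p (D i) ≤ C)
    {A : ℕ → Set ℕ} {δ : ℝ} (hδ : 0 < δ) (hA : ∀ᶠ m in (U : Filter ℕ), δ ≤ p (A m)) :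
    ∃ (m : ℕ → ℕ) (E : ℕ → Set ℕ), StrictMono m ∧ Antitone E ∧ (∀ k, (E k).Nonempty) ∧
      ∀ k, E k ⊆ A (m k) := by
  have h0 : ∀ A, 0 ≤ p A := fun A => hempty.symm.trans_le (hmono _ _ (empty_subset A))
  have hex : ∀ E : Set ℕ, ∃ l, Tendsto (fun m => p (E ∩ A m)) U (𝓝 l) := fun E =>
    exists_tendsto_of_ultrafilter U (fun _ => h0 _) fun _ => hmono _ _ (subset_univ _)
  choose q hq using hex
  -- Here q E is the limit of p (E ∩ A m) along U. If q (E ∩ A m) were 0 for U-most m, one could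
  -- pick N sets E ∩ A m of size above η with overlaps below τ. Disjointing them costs at most Nτ =
  -- η/2 each, and their total then exceeds C.
  have step : ∀ E, 0 < q E → ∃ᶠ m in (U : Filter ℕ), 0 < q (E ∩ A m) := by
    intro E hE
    by_contra hcon
    rw [not_frequently] at hcon
    set η := q E / 2 with hη
    have hη0 : 0 < η := by positivity
    obtain ⟨N, hN⟩ := exists_nat_gt (2 * C / η)
    have hC0 : 0 ≤ C := by simpa using hsum ∅ (fun _ => ∅) (fun _ _ _ => disjoint_empty _)
    have hN0 : (0 : ℝ) < N := lt_of_le_of_lt (by positivity) hN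
    set τ := η / (2 * N) with hτ
    have hτ0 : 0 < τ := by positivity
    have hP : ∀ᶠ m in (U : Filter ℕ), η < p (E ∩ A m) ∧ ¬ 0 < q (E ∩ A m) :=
      ((hq E).eventually_const_lt (by rw [hη]; linarith)).and hcon
    obtain ⟨f, hf1, hf2⟩ := exists_seq_of_forall_finset_exists
      (fun m => η < p (E ∩ A m) ∧ ¬ 0 < q (E ∩ A m)) (fun m n => p (E ∩ A m ∩ A n) < τ) (by
        intro s hs
        have : ∀ᶠ n in (U : Filter ℕ), ∀ m ∈ s, p (E ∩ A m ∩ A n) < τ :=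
          (Finset.eventually_all s).2 fun m hm =>
            (hq (E ∩ A m)).eventually_lt_const (lt_of_le_of_lt (not_lt.1 (hs m hm).2) hτ0)
        exact (hP.and this).exists)
    set B : ℕ → Set ℕ := fun i => E ∩ A (f i) with hB
    have hD : ∀ i ∈ Finset.range N, η / 2 ≤ p (disjointed B i) := by
      intro i hi
      rw [Finset.mem_range] at hi
      have hcover : B i ⊆ disjointed B i ∪ ⋃ j ∈ Finset.range i, (E ∩ A (f j) ∩ A (f i)) := by
        intro s hs
        by_cases hsj : ∃ j < i, s ∈ B j
        · obtain ⟨j, hj, hsj⟩ := hsj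
          exact Or.inr (mem_biUnion (Finset.mem_coe.2 (Finset.mem_range.2 hj)) ⟨hsj, hs.2⟩)
        · push Not at hsj
          refine Or.inl ?_
          rw [disjointed_apply]
          refine ⟨hs, ?_⟩
          simpa using hsj
      have h1 := (hmono _ _ hcover).trans (hsub _ _)
      have h2 := le_sum_of_subadditive hempty hsub (Finset.range i)
        (fun j => E ∩ A (f j) ∩ A (f i))
      have h3 : ∑ j ∈ Finset.range i, p (E ∩ A (f j) ∩ A (f i)) ≤ i * τ := by
        refine (Finset.sum_le_card_nsmul _ _ τ fun j hj =>
          (hf2 j i (Finset.mem_range.1 hj)).le).trans_eq ?_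
        simp
      have h4 : (i : ℝ) * τ ≤ N * τ := by gcongr
      have h5 : N * τ = η / 2 := by rw [hτ]; field_simp
      have h6 := (hf1 i).1
      simp only [hB] at h1
      linarith
    have h1 := hsum (Finset.range N) (disjointed B) (disjoint_disjointed B)
    have h2 := Finset.card_nsmul_le_sum _ _ _ hD
    rw [Finset.card_range, nsmul_eq_mul] at h2
    rw [div_lt_iff₀ hη0] at hN
    linarith
  have hnext : ∀ x : {x : Set ℕ × ℕ // 0 < q x.1}, ∃ y : {x : Set ℕ × ℕ // 0 < q x.1},
      x.1.2 < y.1.2 ∧ y.1.1 = x.1.1 ∩ A y.1.2 := by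
    rintro ⟨⟨E, n⟩, hE⟩
    obtain ⟨m, hm, hnm⟩ := ((step E hE).and_eventually (hU (eventually_gt_atTop n))).exists
    exact ⟨⟨(E ∩ A m, m), hm⟩, hnm, rfl⟩
  choose next hnext1 hnext2 using hnext
  have huniv : 0 < q univ := hδ.trans_le (ge_of_tendsto (hq univ) (by simpa using hA))
  set f : ℕ → {x : Set ℕ × ℕ // 0 < q x.1} := fun n => next^[n] ⟨(univ, 0), huniv⟩
  have hf : ∀ n, f (n + 1) = next (f n) := fun n => Function.iterate_succ_apply' _ _ _
  -- The shift skips the initial state `(univ, 0)`, which need not lie in any A m.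
  refine ⟨fun k => (f (k + 1)).1.2, fun k => (f (k + 1)).1.1, strictMono_nat_of_lt_succ fun k => ?_,
    antitone_nat_of_succ_le fun k => ?_, fun k => ?_, fun k => ?_⟩
  · rw [hf (k + 1)]
    exact hnext1 _
  · rw [hf (k + 1), hnext2]
    exact inter_subset_left
  · obtain ⟨m, hm⟩ := ((hq _).eventually_const_lt (f (k + 1)).2).exists
    by_contra hne
    replace hne : (f (k + 1)).1.1 = ∅ := not_nonempty_iff_eq_empty.1 hne
    rw [hne, empty_inter, hempty] at hm
    exact lt_irrefl _ hm
  · change (f (k + 1)).1.1 ⊆ A (f (k + 1)).1.2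
    rw [hf k, hnext2]
    exact inter_subset_right

theorem infinite_inter_of_eventually {N : Set ℕ} (hN : N.Infinite) {P : ℕ → Prop}
    (hP : ∀ᶠ n in atTop, P n) : (N ∩ {n | P n}).Infinite :=
  Nat.frequently_atTop_iff_infinite.1
    ((Nat.frequently_atTop_iff_infinite.2 hN).and_eventually hP)

/-- Successive extraction of infinite subsets. -/
theorem exists_strictMono_of_forall_infinite {Q : ℕ → ℕ → Set ℕ → Prop}
    (hQ : ∀ i m N N', N' ⊆ N → Q i m N → Q i m N')
    (h : ∀ i N, N.Infinite → ∃ m ∈ N, ∃ N' ⊆ N, N'.Infinite ∧ Q i m N') :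
    ∃ (f : ℕ → ℕ) (N : ℕ → Set ℕ), StrictMono f ∧ (∀ i, Q i (f i) (N i)) ∧
      ∀ i j, i < j → f j ∈ N i := by
  have h' : ∀ i (N : {N : Set ℕ // N.Infinite}), ∃ (m : ℕ) (N' : {N : Set ℕ // N.Infinite}),
      m ∈ N.1 ∧ N'.1 ⊆ N.1 ∧ N'.1 ⊆ Ioi m ∧ Q i m N'.1 := by
    rintro i ⟨N, hN⟩
    obtain ⟨m, hm, N', hN', hinf, hq⟩ := h i N hN
    refine ⟨m, ⟨N' ∩ Ioi m, ?_⟩, hm, inter_subset_left.trans hN', inter_subset_right,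
      hQ _ _ _ _ inter_subset_left hq⟩
    exact infinite_inter_of_eventually hinf (eventually_gt_atTop m)
  choose m next hm hsub hgt hq using h'
  let S : ℕ → {N : Set ℕ // N.Infinite} := fun n =>
    Nat.rec ⟨univ, infinite_univ⟩ (fun i N => next i N) n
  have hS : ∀ i, S (i + 1) = next i (S i) := fun i => rfl
  have hanti : Antitone fun i => (S i).1 := antitone_nat_of_succ_le fun i => by
    rw [hS]; exact hsub _ _
  have hmem : ∀ i j, i < j → m j (S j) ∈ (S (i + 1)).1 := fun i j hij =>
    hanti (Nat.succ_le_of_lt hij) (hm j (S j))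
  refine ⟨fun i => m i (S i), fun i => (S (i + 1)).1, ?_, ?_, hmem⟩
  · intro i j hij
    have := hmem i j hij
    rw [hS] at this
    exact hgt _ _ this
  · exact fun i => hq i (S i)

theorem exists_pairwise_disjoint_infinite {N : Set ℕ} (hN : N.Infinite) :
    ∃ P : ℕ → Set ℕ, Pairwise (Function.onFun Disjoint P) ∧ ∀ j, P j ⊆ N ∧ (P j).Infinite := by
  have hinj := Nat.nth_injective (p := (· ∈ N)) hN
  refine ⟨fun j => range fun k => Nat.nth (· ∈ N) (Nat.pair j k), ?_, fun j => ⟨?_, ?_⟩⟩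
  · intro i j hij
    rw [Function.onFun, disjoint_left]
    rintro _ ⟨k, rfl⟩ ⟨l, hl⟩
    exact hij (Nat.pair_eq_pair.1 (hinj hl)).1.symm
  · rintro _ ⟨k, rfl⟩
    exact Nat.nth_mem_of_infinite hN _
  · refine infinite_range_of_injective fun k l hkl => ?_
    exact (Nat.pair_eq_pair.1 (hinj hkl)).2

end Combinatorics

/-! ### Weak* null sequences of functionals on ℓ^∞ -/

section WeakStarNull

variable {φ : ℕ → StrongDual ℂ SeqInfty} {C : ℝ}

theorem sum_half_pow_le (k : ℕ) {a : ℝ} (ha : 0 ≤ a) :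
    ∑ i ∈ Finset.range k, a * (1 / 2) ^ (i + 1) ≤ a := by
  have h : ∀ k : ℕ, ∑ i ∈ Finset.range k, a * (1 / 2) ^ (i + 1) = a - a * (1 / 2) ^ k := by
    intro k
    induction k with
    | zero => simp
    | succ k ih => rw [Finset.sum_range_succ, ih]; ring
  rw [h]
  have : 0 ≤ a * (1 / 2 : ℝ) ^ k := by positivity
  linarith

theorem tendsto_apply_comp_of_strictMono (h0 : ∀ x, Tendsto (fun n => φ n x) atTop (𝓝 0)) {f : ℕ → ℕ}
    (hf : StrictMono f) (x : SeqInfty) : Tendsto (fun n => φ (f n) x) atTop (𝓝 0) :=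
  (h0 x).comp hf.tendsto_atTop

/-- Phillips' lemma. -/
theorem not_forall_le_norm_apply_cut (hC : ∀ n, ‖φ n‖ ≤ C)
    (h0 : ∀ x, Tendsto (fun n => φ n x) atTop (𝓝 0)) {D : ℕ → Set ℕ}
    (hD : Pairwise (Function.onFun Disjoint D)) (y : SeqInfty) {ε : ℝ} (hε : 0 < ε) :
    ¬ ∀ k, ε ≤ ‖φ k (cut (D k) y)‖ := by
  intro hle
  obtain ⟨f, N, hf, hQ, hN⟩ := exists_strictMono_of_forall_infinite
    (Q := fun i m N => (∀ n ∈ N, ‖φ n (cut (D m) y)‖ ≤ ε / 4 * (1 / 2) ^ (i + 1)) ∧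
      variationOn (φ m) (⋃ k ∈ N, D k) * ‖y‖ ≤ ε / 4)
    (fun i m N N' hN hq => ⟨fun n hn => hq.1 n (hN hn),
      (mul_le_mul_of_nonneg_right (variationOn_mono _ (biUnion_subset_biUnion_left hN))
        (norm_nonneg y)).trans hq.2⟩) (by
    intro i N hN
    obtain ⟨m, hm⟩ := hN.nonempty
    -- N splits into infinitely many infinite pieces with disjoint unions of the D k. As the total
    -- variation of φ m is at most C, it is small on one of these unions.
    obtain ⟨P, hPd, hP⟩ := exists_pairwise_disjoint_infinite hN
    have hdisj : Pairwise (Function.onFun Disjoint fun j => ⋃ k ∈ P j, D k) := by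
      intro j l hjl
      rw [Function.onFun, disjoint_left]
      intro s hs hs'
      simp only [mem_iUnion] at hs hs'
      obtain ⟨a, ha, hsa⟩ := hs
      obtain ⟨b, hb, hsb⟩ := hs'
      have hab : a ≠ b := fun h => disjoint_left.1 (hPd hjl) ha (h ▸ hb)
      exact disjoint_left.1 (hD hab) hsa hsb
    set t := ε / (4 * (‖y‖ + 1)) with ht
    have hy1 : 0 < ‖y‖ + 1 := by positivity
    have ht0 : 0 < t := by positivity
    obtain ⟨K, hK⟩ := exists_nat_gt (C / t)
    obtain ⟨j, hj⟩ : ∃ j, variationOn (φ m) (⋃ k ∈ P j, D k) ≤ t := by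
      by_contra! hcon
      have h1 := (sum_variationOn_le (φ m) (Finset.range K) hdisj).trans (hC m)
      have h2 := Finset.card_nsmul_le_sum (Finset.range K) _ t fun j _ => (hcon j).le
      rw [Finset.card_range, nsmul_eq_mul] at h2
      rw [div_lt_iff₀ ht0] at hK
      linarith
    have hev : ∀ᶠ n in atTop, ‖φ n (cut (D m) y)‖ ≤ ε / 4 * (1 / 2) ^ (i + 1) := by
      have := (h0 (cut (D m) y)).norm
      rw [norm_zero] at this
      exact this.eventually_le_const (by positivity)
    refine ⟨m, hm, _, inter_subset_left.trans (hP j).1,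
      infinite_inter_of_eventually (hP j).2 hev, fun n hn => hn.2, ?_⟩
    calc _ ≤ t * (‖y‖ + 1) := mul_le_mul
          ((variationOn_mono _ (biUnion_subset_biUnion_left inter_subset_left)).trans hj)
          (by linarith) (norm_nonneg _) ht0.le
      _ = ε / 4 := by rw [ht]; field_simp)
  -- The contradiction comes from restricting y to the union of the selected sets: earlier sets and
  -- later sets each contribute at most ε/4, leaving ε/2 from the k-th.
  have hlow : ∀ k, ε / 2 ≤ ‖φ (f k) (cut (⋃ i, D (f i)) y)‖ := by
    intro k
    have hDf : Pairwise (Function.onFun Disjoint fun i => D (f i)) := fun i j hij =>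
      hD (hf.injective.ne hij)
    have hunion : (⋃ i, D (f i)) = (⋃ i ∈ Finset.range (k + 1), D (f i)) ∪ ⋃ i ∈ Ioi k, D (f i) := by
      ext s
      simp only [mem_iUnion, mem_union, Finset.mem_range, mem_Ioi, exists_prop]
      constructor
      · rintro ⟨i, hi⟩
        rcases Nat.lt_or_ge i (k + 1) with h | h
        · exact Or.inl ⟨i, h, hi⟩
        · exact Or.inr ⟨i, h, hi⟩
      · rintro (⟨i, -, hi⟩ | ⟨i, -, hi⟩) <;> exact ⟨i, hi⟩
    have hdisj : Disjoint (⋃ i ∈ Finset.range (k + 1), D (f i)) (⋃ i ∈ Ioi k, D (f i)) := by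
      simp only [disjoint_iUnion_left, disjoint_iUnion_right]
      intro j hj i hi
      refine hDf ?_
      have h1 := Finset.mem_range.1 hi
      have h2 : k < j := hj
      omega
    rw [hunion, cut_union hdisj, cut_biUnion _ hDf, Finset.sum_range_succ, map_add, map_add, map_sum]
    have h1 : ‖∑ i ∈ Finset.range k, φ (f k) (cut (D (f i)) y)‖ ≤ ε / 4 :=
      (norm_sum_le_of_le _ fun i hi =>
        (hQ i).1 _ (hN i k (Finset.mem_range.1 hi))).trans (sum_half_pow_le k (by positivity))
    have h2 : ‖φ (f k) (cut (⋃ i ∈ Ioi k, D (f i)) y)‖ ≤ ε / 4 := by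
      refine (norm_apply_cut_le _ _ _).trans (le_trans ?_ (hQ k).2)
      refine mul_le_mul_of_nonneg_right (variationOn_mono _ ?_) (norm_nonneg y)
      intro s hs
      simp only [mem_iUnion] at hs ⊢
      obtain ⟨i, hi, hs⟩ := hs
      exact ⟨f i, hN k i hi, hs⟩
    have h3 := hle (f k)
    set a := ∑ i ∈ Finset.range k, φ (f k) (cut (D (f i)) y)
    set b := φ (f k) (cut (D (f k)) y)
    set c := φ (f k) (cut (⋃ i ∈ Ioi k, D (f i)) y)
    have h4 : ‖b‖ ≤ ‖a + b + c‖ + ‖a‖ + ‖c‖ := by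
      have : b = (a + b + c) - a - c := by ring
      calc ‖b‖ = ‖(a + b + c) - a - c‖ := by rw [← this]
        _ ≤ _ := (norm_sub_le _ _).trans (by gcongr; exact norm_sub_le _ _)
    linarith
  have hlim := (tendsto_apply_comp_of_strictMono h0 hf (cut (⋃ i, D (f i)) y)).norm
  rw [norm_zero] at hlim
  have := ge_of_tendsto' hlim hlow
  linarith

/-- Gliding hump form of Phillips' lemma, for functionals concentrated on almost disjoint sets. -/
theorem not_forall_le_norm_apply_of_gliding_hump (hC : ∀ n, ‖φ n‖ ≤ C)
    (h0 : ∀ x, Tendsto (fun n => φ n x) atTop (𝓝 0)) {z : ℕ → SeqInfty} (hz : ∀ n, ‖z n‖ ≤ 1)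
    {A : ℕ → Set ℕ} {ε : ℝ} (hε : 0 < ε) (htail : ∀ k, ‖φ k (cut (A k)ᶜ (z k))‖ ≤ ε / 4)
    (hhead : ∀ j k, j < k → variationOn (φ k) (A j) ≤ ε / 4 * (1 / 2) ^ (j + 1)) :
    ¬ ∀ k, ε ≤ ‖φ k (z k)‖ := by
  intro hle
  have hdisj : Pairwise (Function.onFun Disjoint (disjointed A)) := disjoint_disjointed A
  -- A single y carries z k on the k-th disjointed set. Discarding the tail of z k and the overlaps
  -- with earlier sets loses at most ε/4 each, so ε/2 remains for Phillips' lemma.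
  obtain ⟨y, hy⟩ := exists_glue hdisj hz
  refine not_forall_le_norm_apply_cut hC h0 hdisj y (half_pos hε) fun k => ?_
  rw [hy]
  have hA : A k = disjointed A k ∪ (A k \ disjointed A k) :=
    (union_sdiff_cancel (disjointed_subset A k)).symm
  have h1 : z k = cut (disjointed A k) (z k) + cut (A k \ disjointed A k) (z k) + cut (A k)ᶜ (z k) := by
    rw [← cut_union disjoint_sdiff_right, ← hA, cut_add_cut_compl]
  have h2 : ‖φ k (cut (A k \ disjointed A k) (z k))‖ ≤ ε / 4 := by
    refine (norm_apply_cut_le _ _ _).trans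
      ((mul_le_of_le_one_right (variationOn_nonneg _ _) (hz k)).trans ?_)
    have hsub : A k \ disjointed A k ⊆ ⋃ j ∈ Finset.range k, A j := by
      rintro s ⟨hs, hs'⟩
      by_contra hcon
      refine hs' ?_
      rw [disjointed_apply]
      refine ⟨hs, ?_⟩
      simpa using hcon
    refine (variationOn_mono _ hsub).trans ((le_sum_of_subadditive (variationOn_empty _)
      (variationOn_union_le _) _ _).trans ?_)
    exact (Finset.sum_le_sum fun j hj => hhead j k (Finset.mem_range.1 hj)).trans
      (sum_half_pow_le k (by positivity))
  have h3 := hle k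
  have h4 := htail k
  rw [h1, map_add, map_add] at h3
  have h5 := norm_add₃_le (a := φ k (cut (disjointed A k) (z k)))
    (b := φ k (cut (A k \ disjointed A k) (z k))) (c := φ k (cut (A k)ᶜ (z k)))
  linarith

/-- The limit of bounded sequences along an ultrafilter is a bounded functional. -/
theorem exists_dual_tendsto_ultrafilter (G : Ultrafilter ℕ) :
    ∃ χ : StrongDual ℂ SeqInfty, ∀ x : SeqInfty, Tendsto (fun s => x s) G (𝓝 (χ x)) := by
  have hex : ∀ x : SeqInfty, ∃ l ∈ Metric.closedBall (0 : ℂ) ‖x‖, Tendsto (fun s => x s) G (𝓝 l) := by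
    intro x
    obtain ⟨l, hl, h⟩ := (isCompact_closedBall (0 : ℂ) ‖x‖).ultrafilter_le_nhds
      (G.map fun s => x s) (le_principal_iff.2 (mem_map.2 (univ_mem' fun s => by
        simpa using lp.norm_apply_le_norm (by simp) x s)))
    exact ⟨l, hl, h⟩
  choose l hl hlim using hex
  refine ⟨LinearMap.mkContinuous
    { toFun := l
      map_add' := fun x y => tendsto_nhds_unique (hlim (x + y)) ((hlim x).add (hlim y))
      map_smul' := fun c x => tendsto_nhds_unique (hlim (c • x)) ((hlim x).const_smul c) } 1
    fun x => ?_, hlim⟩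
  rw [one_mul]
  simpa using hl x

/-- Otherwise the limit of the variations along an ultrafilter on N is at least τ on every set {|x
m| > η}. A subsequence of these sets then has the finite intersection property, and an ultrafilter
limit through them is a functional of modulus at least η on that subsequence, contradicting weak
nullity. -/
theorem exists_infinite_variationOn_le (hC : ∀ n, ‖φ n‖ ≤ C) {x : ℕ → SeqInfty}
    (hx : ∀ ψ : StrongDual ℂ SeqInfty, Tendsto (fun n => ψ (x n)) atTop (𝓝 0)) {η τ : ℝ} (hη : 0 < η)
    (hτ : 0 < τ) {N : Set ℕ} (hN : N.Infinite) :
    ∃ m ∈ N, ∃ N' ⊆ N, N'.Infinite ∧ ∀ n ∈ N', variationOn (φ n) {s | η < ‖x m s‖} ≤ τ := by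
  by_contra! hcon
  have hne : NeBot (atTop ⊓ 𝓟 N : Filter ℕ) :=
    frequently_mem_iff_neBot.1 (Nat.frequently_atTop_iff_infinite.2 hN)
  set U : Ultrafilter ℕ := Ultrafilter.of (atTop ⊓ 𝓟 N)
  have hU : (U : Filter ℕ) ≤ atTop ⊓ 𝓟 N := Ultrafilter.of_le _
  have hex : ∀ A : Set ℕ, ∃ l, Tendsto (fun n => variationOn (φ n) A) U (𝓝 l) := fun A =>
    exists_tendsto_of_ultrafilter U (fun _ => variationOn_nonneg _ _)
      fun n => (variationOn_le_norm _ _).trans (hC n)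
  choose p hp using hex
  have hlow : ∀ m ∈ N, τ ≤ p {s | η < ‖x m s‖} := by
    intro m hm
    refine ge_of_tendsto (hp _) ?_
    have hfin : ¬ (N ∩ {n | variationOn (φ n) {s | η < ‖x m s‖} ≤ τ}).Infinite := fun hinf => by
      obtain ⟨n, hn, hlt⟩ := hcon m hm _ inter_subset_left hinf
      exact absurd hn.2 (not_le.2 hlt)
    replace hfin := not_frequently.1 (mt Nat.frequently_atTop_iff_infinite.1 hfin)
    filter_upwards [hU (mem_inf_of_left hfin), hU (mem_inf_of_right (mem_principal_self N))]
      with n hn hnN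
    by_contra hlt
    exact hn ⟨hnN, (not_le.1 hlt).le⟩
  obtain ⟨m, E, hm, hE, hEne, hEA⟩ := exists_strictMono_antitone_subset
    (hU.trans inf_le_left) (p := p) (C := C)
    (fun A B h => le_of_tendsto_of_tendsto' (hp A) (hp B) fun _ => variationOn_mono _ h)
    (tendsto_nhds_unique (hp ∅) (by simp [variationOn_empty]))
    (fun A B => le_of_tendsto_of_tendsto' (hp _) ((hp A).add (hp B)) fun _ => variationOn_union_le _ _ _)
    (fun s D hD => le_of_tendsto' (tendsto_finsetSum s fun i _ => hp (D i)) fun n =>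
      (sum_variationOn_le (φ n) s hD).trans (hC n))
    hτ (A := fun m => {s | η < ‖x m s‖})
    (Filter.mem_of_superset (hU (mem_inf_of_right (mem_principal_self N))) hlow)
  have hG : NeBot (⨅ k, 𝓟 (E k)) :=
    iInf_neBot_of_directed (fun i j => ⟨max i j, principal_mono.2 (hE (le_max_left i j)),
      principal_mono.2 (hE (le_max_right i j))⟩) fun k => principal_neBot_iff.2 (hEne k)
  set G : Ultrafilter ℕ := Ultrafilter.of (⨅ k, 𝓟 (E k))
  have hGE : ∀ k, E k ∈ (G : Filter ℕ) := fun k =>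
    (Ultrafilter.of_le _) (mem_iInf_of_mem k (mem_principal_self _))
  obtain ⟨χ, hχ⟩ := exists_dual_tendsto_ultrafilter G
  have hχlow : ∀ k, η ≤ ‖χ (x (m k))‖ := fun k =>
    ge_of_tendsto (hχ (x (m k))).norm (Filter.mem_of_superset (hGE k) fun s hs =>
      le_of_lt (show η < ‖x (m k) s‖ from hEA k hs))
  have hlim := ((hx χ).comp hm.tendsto_atTop).norm
  rw [norm_zero] at hlim
  exact absurd (ge_of_tendsto' hlim hχlow) (not_le.2 hη)

/-- Weak* null sequences of functionals on the bounded sequences tend to zero on weakly null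
sequences: this combines the Grothendieck and the Dunford-Pettis property. -/
theorem not_forall_le_norm_apply_of_weakly_null (hC : ∀ n, ‖φ n‖ ≤ C)
    (h0 : ∀ x, Tendsto (fun n => φ n x) atTop (𝓝 0)) {x : ℕ → SeqInfty} (hx1 : ∀ n, ‖x n‖ ≤ 1)
    (hx : ∀ ψ : StrongDual ℂ SeqInfty, Tendsto (fun n => ψ (x n)) atTop (𝓝 0)) {ε : ℝ} (hε : 0 < ε) :
    ¬ ∀ n, ε ≤ ‖φ n (x n)‖ := by
  intro hle
  have hC0 : 0 ≤ C := (norm_nonneg _).trans (hC 0)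
  -- With this η the coordinates of x n of modulus at most η contribute at most ε/4.
  set η := ε / (4 * (C + 1)) with hη
  have hη0 : 0 < η := by positivity
  obtain ⟨f, N, hf, hQ, hN⟩ := exists_strictMono_of_forall_infinite
    (Q := fun i m N => ∀ n ∈ N, variationOn (φ n) {s | η < ‖x m s‖} ≤ ε / 4 * (1 / 2) ^ (i + 1))
    (fun i m N N' hN hq n hn => hq n (hN hn))
    (fun i N hN => exists_infinite_variationOn_le hC hx hη0 (by positivity) hN)
  refine not_forall_le_norm_apply_of_gliding_hump (φ := fun k => φ (f k)) (fun k => hC _)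
    (fun y => tendsto_apply_comp_of_strictMono h0 hf y) (z := fun k => x (f k)) (fun k => hx1 _)
    (A := fun k => {s | η < ‖x (f k) s‖}) hε (fun k => ?_)
    (fun j k hjk => hQ j _ (hN j k hjk)) fun k => hle _
  have h1 : ‖cut {s | η < ‖x (f k) s‖}ᶜ (x (f k))‖ ≤ η := by
    refine lp.norm_le_of_forall_le hη0.le fun s => ?_
    rw [cut_apply]
    by_cases hs : s ∈ {s | η < ‖x (f k) s‖}ᶜ
    · rw [indicator_of_mem hs]
      exact not_lt.1 hs
    · rw [indicator_of_notMem hs, norm_zero]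
      exact hη0.le
  calc _ ≤ ‖φ (f k)‖ * ‖cut {s | η < ‖x (f k) s‖}ᶜ (x (f k))‖ := (φ (f k)).le_opNorm _
    _ ≤ (C + 1) * η := mul_le_mul ((hC _).trans (by linarith)) h1 (norm_nonneg _) (by linarith)
    _ = ε / 4 := by rw [hη]; field_simp

end WeakStarNull

/-! ### The pairing with ℓ^1 and the Schur property -/

section Pairing

theorem hasSum_norm_seqOne (x : SeqOne) : HasSum (fun s => ‖x s‖) ‖x‖ := by
  simpa using lp.hasSum_norm (p := 1) (by simp) x

theorem norm_mul_le_seq (x : SeqOne) (y : SeqInfty) (s : ℕ) : ‖x s * y s‖ ≤ ‖x s‖ * ‖y‖ := by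
  rw [norm_mul]
  exact mul_le_mul_of_nonneg_left (lp.norm_apply_le_norm (by simp) y s) (norm_nonneg _)

theorem summable_mul_seq (x : SeqOne) (y : SeqInfty) : Summable fun s => x s * y s :=
  Summable.of_norm_bounded ((hasSum_norm_seqOne x).summable.mul_right ‖y‖) (norm_mul_le_seq x y)

/-- The pairing `⟨x, y⟩ = ∑ n, x n * y n`, as a map from the summable sequences to the functionals
on the bounded sequences. -/
def pairing : SeqOne →L[ℂ] StrongDual ℂ SeqInfty :=
  LinearMap.mkContinuous₂
    (LinearMap.mk₂ ℂ (fun (x : SeqOne) (y : SeqInfty) => ∑' s, x s * y s)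
      (fun x x' y => by
        rw [← (summable_mul_seq x y).tsum_add (summable_mul_seq x' y)]
        exact tsum_congr fun s => add_mul _ _ _)
      (fun c x y => by
        rw [smul_eq_mul, ← tsum_mul_left]
        exact tsum_congr fun s => mul_assoc _ _ _)
      (fun x y y' => by
        rw [← (summable_mul_seq x y).tsum_add (summable_mul_seq x y')]
        exact tsum_congr fun s => mul_add _ _ _)
      (fun c x y => by
        rw [smul_eq_mul, ← tsum_mul_left]
        exact tsum_congr fun s => mul_left_comm _ _ _)) 1
    fun x y => by
      rw [one_mul]
      exact tsum_of_norm_bounded ((hasSum_norm_seqOne x).mul_right ‖y‖) (norm_mul_le_seq x y)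

theorem pairing_apply (x : SeqOne) (y : SeqInfty) : pairing x y = ∑' s, x s * y s := rfl

theorem norm_pairing_le (x : SeqOne) : ‖pairing x‖ ≤ ‖x‖ := by
  refine ContinuousLinearMap.opNorm_le_bound _ (norm_nonneg x) fun y => ?_
  exact tsum_of_norm_bounded ((hasSum_norm_seqOne x).mul_right ‖y‖) (norm_mul_le_seq x y)

theorem pairing_single (i : ℕ) (a : ℂ) (y : SeqInfty) : pairing (lp.single 1 i a) y = a * y i := by
  rw [pairing_apply, tsum_eq_single i]
  · rw [lp.single_apply_self]
  · intro j hj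
    rw [lp.single_apply_ne _ _ _ hj, zero_mul]

theorem exists_pairing_eq_norm (x : SeqOne) : ∃ z : SeqInfty, ‖z‖ ≤ 1 ∧ pairing x z = (‖x‖ : ℂ) := by
  choose c hc hcx using fun s => RCLike.exists_norm_eq_mul_self (K := ℂ) (x s)
  let z : SeqInfty := ⟨c, memℓp_infty ⟨1, by rintro _ ⟨s, rfl⟩; exact (hc s).le⟩⟩
  refine ⟨z, lp.norm_le_of_forall_le zero_le_one fun s => (hc s).le, ?_⟩
  have h1 : HasSum (fun s => ((‖x s‖ : ℝ) : ℂ)) ((‖x‖ : ℝ) : ℂ) :=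
    Complex.hasSum_ofReal.2 (hasSum_norm_seqOne x)
  rw [pairing_apply, ← h1.tsum_eq]
  refine tsum_congr fun s => ?_
  rw [mul_comm]
  exact (hcx s).symm

theorem variationOn_pairing_le (x : SeqOne) (A : Set ℕ) :
    variationOn (pairing x) A ≤ ∑' s, A.indicator (fun s => ‖x s‖) s := by
  have hsum := (hasSum_norm_seqOne x).summable.indicator A
  refine ContinuousLinearMap.opNorm_le_bound _
    (tsum_nonneg fun s => indicator_nonneg (fun _ _ => norm_nonneg _) s) fun y => ?_
  refine tsum_of_norm_bounded (hsum.hasSum.mul_right ‖y‖) fun s => ?_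
  change ‖x s * A.indicator y s‖ ≤ _
  by_cases hs : s ∈ A
  · rw [indicator_of_mem hs, indicator_of_mem hs]
    exact norm_mul_le_seq x y s
  · rw [indicator_of_notMem hs, indicator_of_notMem hs, mul_zero, norm_zero, zero_mul]

theorem variationOn_pairing_Iio_le (x : SeqOne) (K : ℕ) :
    variationOn (pairing x) (Iio K) ≤ ∑ s ∈ Finset.range K, ‖x s‖ := by
  refine (variationOn_pairing_le x _).trans_eq ?_
  rw [tsum_eq_sum (s := Finset.range K)]
  · exact Finset.sum_congr rfl fun s hs => indicator_of_mem (by simpa using hs) _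
  · intro s hs
    exact indicator_of_notMem (by simpa using hs) _

theorem tendsto_variationOn_pairing_Ici (x : SeqOne) :
    Tendsto (fun K => variationOn (pairing x) (Iio K)ᶜ) atTop (𝓝 0) := by
  refine squeeze_zero (fun _ => variationOn_nonneg _ _)
    (fun K => variationOn_pairing_le x (Iio K)ᶜ) ?_
  have h1 : ∀ K, ∑' s, (Iio K)ᶜ.indicator (fun s => ‖x s‖) s =
      ‖x‖ - ∑ s ∈ Finset.range K, ‖x s‖ := by
    intro K
    have hs := (hasSum_norm_seqOne x).summable
    have hK : (Iio K)ᶜ = ((Finset.range K : Set ℕ))ᶜ := by rw [Finset.coe_range]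
    rw [← (hasSum_norm_seqOne x).tsum_eq, hK, ← tsum_subtype, eq_sub_iff_add_eq',
      ← hs.sum_add_tsum_compl (s := Finset.range K)]
  simp only [h1]
  have := (hasSum_norm_seqOne x).tendsto_sum_nat.const_sub ‖x‖
  rwa [sub_self] at this

/-- The Schur property of the space of summable sequences. -/
theorem not_forall_le_norm_of_weakly_null {x : ℕ → SeqOne} {C : ℝ} (hC : ∀ n, ‖x n‖ ≤ C)
    (h0 : ∀ y, Tendsto (fun n => pairing (x n) y) atTop (𝓝 0)) {ε : ℝ} (hε : 0 < ε) :
    ¬ ∀ n, ε ≤ ‖x n‖ := by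
  intro hle
  have hcoord : ∀ s, Tendsto (fun n => ‖x n s‖) atTop (𝓝 0) := by
    intro s
    have := (h0 (lp.single ∞ s 1)).norm
    rw [norm_zero] at this
    refine this.congr fun n => ?_
    rw [pairing_apply, tsum_eq_single s]
    · rw [lp.single_apply_self, mul_one]
    · intro j hj
      rw [lp.single_apply_ne _ _ _ hj, mul_zero]
  -- Gliding hump on initial segments: each x m is nearly supported on some `Iio K`, while
  -- coordinatewise convergence makes later x n small there.
  obtain ⟨f, N, hf, hQ, hN⟩ := exists_strictMono_of_forall_infinite
    (Q := fun i m N => ∃ K : ℕ, variationOn (pairing (x m)) (Iio K)ᶜ ≤ ε / 4 ∧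
      ∀ n ∈ N, variationOn (pairing (x n)) (Iio K) ≤ ε / 4 * (1 / 2) ^ (i + 1))
    (fun i m N N' hN ⟨K, hK, hq⟩ => ⟨K, hK, fun n hn => hq n (hN hn)⟩) (by
    intro i N hN
    obtain ⟨m, hm⟩ := hN.nonempty
    obtain ⟨K, hK⟩ := ((tendsto_variationOn_pairing_Ici (x m)).eventually_le_const
      (show (0 : ℝ) < ε / 4 by positivity)).exists
    have h1 : Tendsto (fun n => ∑ s ∈ Finset.range K, ‖x n s‖) atTop (𝓝 0) := by
      simpa using tendsto_finsetSum (Finset.range K) fun s _ => hcoord s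
    have h2 : ∀ᶠ n in atTop, variationOn (pairing (x n)) (Iio K) ≤ ε / 4 * (1 / 2) ^ (i + 1) :=
      (h1.eventually_le_const (by positivity)).mono fun n hn =>
        (variationOn_pairing_Iio_le _ _).trans hn
    exact ⟨m, hm, _, inter_subset_left, infinite_inter_of_eventually hN h2, K, hK,
      fun n hn => hn.2⟩)
  choose K hK1 hK2 using hQ
  choose z hz1 hz2 using fun n => exists_pairing_eq_norm (x n)
  refine not_forall_le_norm_apply_of_gliding_hump (φ := fun k => pairing (x (f k)))
    (fun k => (norm_pairing_le _).trans (hC _)) (fun y => (h0 y).comp hf.tendsto_atTop)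
    (z := fun k => z (f k)) (fun k => hz1 _) (A := fun k => Iio (K k)) hε (fun k => ?_)
    (fun j k hjk => hK2 j _ (hN j k hjk)) fun k => ?_
  · exact (norm_apply_cut_le _ _ _).trans
      ((mul_le_of_le_one_right (variationOn_nonneg _ _) (hz1 _)).trans (hK1 k))
  · rw [hz2, Complex.norm_real, norm_norm]
    exact hle _

end Pairing

/-! ### Weakly compact operators on ℓ^∞ -/

section WeaklyCompact

variable {W : SeqInfty →L[ℂ] SeqInfty}

theorem convex_image_closedBall (A : SeqInfty →L[ℂ] SeqInfty) :
    Convex ℝ (A '' Metric.closedBall 0 1) :=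
  (convex_closedBall (0 : SeqInfty) 1).is_linear_image
    ((A.restrictScalars ℝ : SeqInfty →L[ℝ] SeqInfty) : SeqInfty →ₗ[ℝ] SeqInfty).isLinear

theorem IsWeaklyCompactOp.isCompact_closure (hW : IsWeaklyCompactOp W) :
    IsCompact (toWeakSpace ℂ SeqInfty '' closure (W '' Metric.closedBall 0 1)) := by
  rw [(convex_image_closedBall W).toWeakSpace_closure ℂ]
  exact hW

theorem continuous_dual_weakSpace (ψ : StrongDual ℂ SeqInfty) :
    Continuous fun x : WeakSpace ℂ SeqInfty => ψ ((toWeakSpace ℂ SeqInfty).symm x) :=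
  WeakBilin.eval_continuous (topDualPairing ℂ SeqInfty).flip ψ

/-- A direct Eberlein-Šmulian argument: a coordinatewise convergent subsequence has at most one weak
cluster point, as coordinates separate points, and weak compactness turns uniqueness into
convergence. -/
theorem IsWeaklyCompactOp.exists_subseq (hW : IsWeaklyCompactOp W) {u : ℕ → SeqInfty}
    (hu : ∀ n, ‖u n‖ ≤ 1) : ∃ (θ : ℕ → ℕ) (x : SeqInfty), StrictMono θ ∧
      ∀ ψ : StrongDual ℂ SeqInfty, Tendsto (fun n => ψ (W (u (θ n)))) atTop (𝓝 (ψ x)) := by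
  have hcpt : IsCompact (Set.pi univ fun _ : ℕ => Metric.closedBall (0 : ℂ) ‖W‖) :=
    isCompact_univ_pi fun _ => isCompact_closedBall _ _
  obtain ⟨a, -, θ, hθ, ha⟩ := hcpt.tendsto_subseq (x := fun n => (W (u n) : ℕ → ℂ)) fun n s _ => by
    have h1 := lp.norm_apply_le_norm (by simp) (W (u n)) s
    have h2 := W.le_opNorm_of_le (hu n)
    rw [mul_one] at h2
    simpa using h1.trans h2
  have hmem : ∀ n, toWeakSpace ℂ SeqInfty (W (u (θ n))) ∈
      toWeakSpace ℂ SeqInfty '' closure (W '' Metric.closedBall 0 1) := fun n =>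
    mem_image_of_mem _ (subset_closure (mem_image_of_mem _ (by simpa using hu (θ n))))
  have hcoord : ∀ y : WeakSpace ℂ SeqInfty,
      MapClusterPt y atTop (fun n => toWeakSpace ℂ SeqInfty (W (u (θ n)))) →
      ∀ s, (toWeakSpace ℂ SeqInfty).symm y s = a s := by
    intro y hy s
    have h1 := hy.continuousAt_comp (continuous_dual_weakSpace (lp.evalCLM ℂ (fun _ : ℕ => ℂ) ∞ s)).continuousAt
    have h2 : Tendsto (fun n => W (u (θ n)) s) atTop (𝓝 (a s)) := (tendsto_pi_nhds.1 ha) s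
    have : NeBot (𝓝 ((toWeakSpace ℂ SeqInfty).symm y s) ⊓ 𝓝 (a s)) := h1.clusterPt.mono h2
    exact eq_of_nhds_neBot this
  obtain ⟨y, -, hy⟩ := hW.isCompact_closure
    (f := map (fun n => toWeakSpace ℂ SeqInfty (W (u (θ n)))) atTop)
    (le_principal_iff.2 (mem_map.2 (univ_mem' hmem)))
  have hlim := hW.isCompact_closure.tendsto_nhds_of_unique_mapClusterPt (y := y)
    (Eventually.of_forall hmem) fun y' _ hy' => by
      apply (toWeakSpace ℂ SeqInfty).symm.injective
      ext s
      exact (hcoord y' hy' s).trans (hcoord y hy s).symm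
  exact ⟨θ, (toWeakSpace ℂ SeqInfty).symm y, hθ, fun ψ =>
    ((continuous_dual_weakSpace ψ).tendsto y).comp hlim⟩

theorem exists_half_norm_le {E F : Type*} [NormedAddCommGroup E] [NormedSpace ℂ E]
    [NormedAddCommGroup F] [NormedSpace ℂ F] (A : E →L[ℂ] F) {ε : ℝ} (hε : 0 < ε) (h : ε ≤ ‖A‖) :
    ∃ u, ‖u‖ ≤ 1 ∧ ε / 2 ≤ ‖A u‖ := by
  by_contra! hcon
  have := ContinuousLinearMap.opNorm_le_of_unit_norm (𝕜 := ℂ) (f := A) (half_pos hε).le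
    fun x hx => (hcon x hx.le).le
  linarith

/-- The adjoint of a weakly compact operator on the bounded sequences maps bounded weak* null
sequences to norm null sequences. -/
theorem IsWeaklyCompactOp.tendsto_norm_comp (hW : IsWeaklyCompactOp W)
    {φ : ℕ → StrongDual ℂ SeqInfty} {C : ℝ} (hC : ∀ n, ‖φ n‖ ≤ C)
    (h0 : ∀ x, Tendsto (fun n => φ n x) atTop (𝓝 0)) :
    Tendsto (fun n => ‖(φ n).comp W‖) atTop (𝓝 0) := by
  by_contra hcon
  obtain ⟨ε, hε, hfreq⟩ : ∃ ε > 0, ∃ᶠ n in atTop, ε ≤ ‖(φ n).comp W‖ := by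
    simp only [Metric.tendsto_nhds, not_forall, exists_prop, not_eventually] at hcon
    obtain ⟨ε, hε, h⟩ := hcon
    exact ⟨ε, hε, h.mono fun n hn => by simpa using hn⟩
  obtain ⟨ρ, hρ, hle⟩ := extraction_of_frequently_atTop hfreq
  choose u hu1 hu2 using fun n => exists_half_norm_le _ hε (hle n)
  obtain ⟨θ, x, hθ, hx⟩ := hW.exists_subseq hu1
  have hφx : ∀ᶠ n in atTop, ‖φ (ρ (θ n)) x‖ ≤ ε / 4 := by
    have := ((h0 x).comp (hρ.comp hθ).tendsto_atTop).norm
    rw [norm_zero] at this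
    exact this.eventually_le_const (by positivity)
  obtain ⟨n₀, hn₀⟩ := eventually_atTop.1 hφx
  -- Division by B puts the weakly null differences W u - x in the unit ball. After the shift by n₀
  -- the term φ(x) costs at most ε/4 of the available ε/2.
  set B : ℝ := ‖W‖ + ‖x‖ + 1 with hB
  have hB0 : 0 < B := by positivity
  have hinv : ‖((B : ℂ))⁻¹‖ = B⁻¹ := by rw [norm_inv, Complex.norm_real, Real.norm_of_nonneg hB0.le]
  have hshift : StrictMono fun n => ρ (θ (n + n₀)) := fun a b hab =>
    hρ (hθ (Nat.add_lt_add_right hab n₀))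
  refine not_forall_le_norm_apply_of_weakly_null (φ := fun n => φ (ρ (θ (n + n₀)))) (fun n => hC _)
    (fun y => (h0 y).comp hshift.tendsto_atTop)
    (x := fun n => (B : ℂ)⁻¹ • (W (u (θ (n + n₀))) - x)) (fun n => ?_) (fun ψ => ?_)
    (ε := B⁻¹ * (ε / 4)) (by positivity) fun n => ?_
  · rw [norm_smul, hinv, inv_mul_le_one₀ hB0]
    have h1 := W.le_opNorm_of_le (hu1 (θ (n + n₀)))
    rw [mul_one] at h1
    exact (norm_sub_le _ _).trans (by linarith)
  · have h1 := ((hx ψ).comp (tendsto_add_atTop_nat n₀)).sub_const (ψ x)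
    rw [sub_self] at h1
    simpa using h1.const_mul ((B : ℂ)⁻¹)
  · rw [map_smul, norm_smul, hinv]
    refine mul_le_mul_of_nonneg_left ?_ (by positivity)
    have h1 := hu2 (θ (n + n₀))
    have h2 := hn₀ (n + n₀) (by omega)
    rw [ContinuousLinearMap.comp_apply] at h1
    rw [map_sub]
    have h3 := norm_sub_norm_le (φ (ρ (θ (n + n₀))) (W (u (θ (n + n₀))))) (φ (ρ (θ (n + n₀))) x)
    linarith

end WeaklyCompact

/-! ### Lower bounds for adjoints of `S* + W` -/

section AdjointPlusWeaklyCompact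

/-- Continuous functionals on `ℕ → ℂ` depend on finitely many coordinates only. -/
theorem exists_finset_forall_dual_pi_eq_sum (f : StrongDual ℂ (ℕ → ℂ)) :
    ∃ I : Finset ℕ, ∀ z, f z = ∑ i ∈ I, f (Pi.single i 1) * z i := by
  have hmem : f ⁻¹' Metric.ball 0 1 ∈ 𝓝 (0 : ℕ → ℂ) :=
    f.continuous.continuousAt.preimage_mem_nhds (by simpa using Metric.ball_mem_nhds (0 : ℂ) one_pos)
  rw [nhds_pi, Filter.mem_pi] at hmem
  obtain ⟨I, hI, t, ht, hsub⟩ := hmem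
  have hzero : ∀ z : ℕ → ℂ, (∀ i ∈ I, z i = 0) → f z = 0 := by
    intro z hz
    by_contra hne
    have h1 : ((f z)⁻¹ • z) ∈ I.pi t := fun i hi => by
      rw [Pi.smul_apply, hz i hi, smul_zero]
      exact mem_of_mem_nhds (ht i)
    have h2 := hsub h1
    rw [mem_preimage, map_smul, smul_eq_mul, inv_mul_cancel₀ hne] at h2
    simp at h2
  refine ⟨hI.toFinset, fun z => ?_⟩
  have h1 := hzero (z - ∑ i ∈ hI.toFinset, z i • (Pi.single i (1 : ℂ) : ℕ → ℂ)) fun j hj => by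
    rw [Pi.sub_apply, Finset.sum_apply, Finset.sum_eq_single j]
    · simp
    · intro i _ hij
      simp [Pi.single_eq_of_ne hij.symm]
    · intro h
      exact absurd (hI.mem_toFinset.2 hj) h
  rw [map_sub, map_sum, sub_eq_zero] at h1
  rw [h1]
  exact Finset.sum_congr rfl fun i _ => by rw [map_smul, smul_eq_mul, mul_comm]

variable {S : SeqOne →L[ℂ] SeqOne} {R W : SeqInfty →L[ℂ] SeqInfty}

theorem IsAdjointOp.pairing_apply (h : IsAdjointOp S R) (x : SeqOne) (y : SeqInfty) :
    pairing x (R y) = pairing (S x) y := h x y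

theorem IsAdjointOp.apply_eq_tsum (h : IsAdjointOp S R) (y : SeqInfty) (n : ℕ) :
    R y n = ∑' k, S (lp.single 1 n 1) k * y k := by
  have := h.pairing_apply (lp.single 1 n 1) y
  rwa [pairing_single, one_mul] at this

theorem IsAdjointOp.sub_smul (h : IsAdjointOp S R) (μ : ℂ) :
    IsAdjointOp (S - μ • (1 : SeqOne →L[ℂ] SeqOne)) (R - μ • (1 : SeqInfty →L[ℂ] SeqInfty)) := by
  intro x y
  change pairing x (R y - μ • y) = pairing (S x - μ • x) y
  rw [map_sub, map_sub, map_smul, map_smul, h.pairing_apply]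
  rfl

theorem sub_smul_mem_adjointPlusWeaklyCompact {T : SeqInfty →L[ℂ] SeqInfty}
    (hT : T ∈ adjointPlusWeaklyCompact) (μ : ℂ) :
    T - μ • (1 : SeqInfty →L[ℂ] SeqInfty) ∈ adjointPlusWeaklyCompact := by
  obtain ⟨S, R, W, hR, hW, rfl⟩ := hT
  exact ⟨_, _, W, hR.sub_smul μ, hW, by abel⟩

/-- The coordinates of a bounded sequence. -/
def coordinates : SeqInfty →ₗ[ℂ] (ℕ → ℂ) where
  toFun x := x
  map_add' _ _ := rfl
  map_smul' _ _ := rfl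

theorem coordinates_injective : Function.Injective coordinates := fun _ _ h => lp.ext h

/-- Being an adjoint, R has rows in ℓ^1, so it is continuous for coordinatewise convergence on the
unit ball, a product of discs compact by Tychonoff. -/
theorem IsAdjointOp.isCompact_coordinates (h : IsAdjointOp S R) :
    IsCompact (coordinates '' (R '' Metric.closedBall 0 1)) := by
  set P := Set.pi univ fun _ : ℕ => Metric.closedBall (0 : ℂ) 1
  set G : (ℕ → ℂ) → ℕ → ℂ := fun z n => ∑' k, S (lp.single 1 n 1) k * z k
  have hP : IsCompact P := isCompact_univ_pi fun _ => isCompact_closedBall _ _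
  have hG : ContinuousOn G P := by
    refine continuousOn_pi.2 fun n => ?_
    refine continuousOn_tsum (u := fun k => ‖S (lp.single 1 n 1) k‖)
      (fun k => (continuous_const.mul (continuous_apply k)).continuousOn)
      (hasSum_norm_seqOne _).summable fun k z hz => ?_
    rw [norm_mul]
    exact mul_le_of_le_one_right (norm_nonneg _) (by simpa using hz k (mem_univ k))
  have heq : coordinates '' (R '' Metric.closedBall 0 1) = G '' P := by
    ext a
    constructor
    · rintro ⟨_, ⟨z, hz, rfl⟩, rfl⟩
      refine ⟨z, fun k _ => ?_, ?_⟩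
      · have h1 := lp.norm_apply_le_norm (by simp) z k
        have h2 : ‖z‖ ≤ 1 := by simpa using hz
        simpa using h1.trans h2
      · funext n
        exact (h.apply_eq_tsum z n).symm
    · rintro ⟨z, hz, rfl⟩
      have hz' : ∀ k, ‖z k‖ ≤ 1 := fun k => by simpa using hz k (mem_univ k)
      let y : SeqInfty := ⟨z, memℓp_infty ⟨1, by rintro _ ⟨s, rfl⟩; exact hz' s⟩⟩
      refine ⟨R y, ⟨y, ?_, rfl⟩, ?_⟩
      · simpa using lp.norm_le_of_forall_le zero_le_one hz'
      · funext n
        exact h.apply_eq_tsum y n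
  rw [heq]
  exact hP.image_of_continuousOn hG

theorem IsWeaklyCompactOp.isCompact_coordinates (hW : IsWeaklyCompactOp W) :
    IsCompact (coordinates '' closure (W '' Metric.closedBall 0 1)) := by
  have hcont : Continuous fun x : WeakSpace ℂ SeqInfty =>
      coordinates ((toWeakSpace ℂ SeqInfty).symm x) :=
    continuous_pi fun s => continuous_dual_weakSpace (lp.evalCLM ℂ (fun _ : ℕ => ℂ) ∞ s)
  have := hW.isCompact_closure.image hcont
  rw [image_image] at this
  exact this

theorem norm_add_norm_le_of_forall_re_lt {E F : Type*} [NormedAddCommGroup E] [NormedSpace ℂ E]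
    [NormedAddCommGroup F] [NormedSpace ℂ F] {φ : StrongDual ℂ F} {A : E →L[ℂ] F} {a u : ℝ}
    (h : ∀ v, ‖v‖ ≤ 1 → a + (φ (A v)).re < u) : a + ‖φ.comp A‖ ≤ u := by
  rw [← le_sub_iff_add_le']
  have h0 := h 0 (by simp)
  simp only [map_zero, Complex.zero_re, add_zero] at h0
  refine ContinuousLinearMap.opNorm_le_of_unit_norm (𝕜 := ℂ) (by linarith) fun v hv => ?_
  obtain ⟨c, hc, hcv⟩ := RCLike.exists_norm_eq_mul_self (K := ℂ) (φ (A v))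
  have h1 := h (c • v) (by rw [norm_smul, hc, hv, one_mul])
  rw [map_smul, map_smul, smul_eq_mul, ← hcv] at h1
  change a + ‖φ (A v)‖ < u at h1
  rw [ContinuousLinearMap.comp_apply]
  linarith

open scoped Pointwise in
/-- If `S` and the restriction of `W*` are jointly bounded below on the summable sequences, then
every bounded sequence in a ball is of the form `S* z + w` with `‖z‖ ≤ 1` and `w` in the closure of
the image of the unit ball under `W`. -/
theorem exists_add_eq_smul (hR : IsAdjointOp S R) (hW : IsWeaklyCompactOp W) {c : ℝ} (hc : 0 ≤ c)
    (h : ∀ x : SeqOne, c * ‖x‖ ≤ ‖S x‖ + ‖(pairing x).comp W‖) {y : SeqInfty} (hy : ‖y‖ ≤ 1) :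
    ∃ z w, ‖z‖ ≤ 1 ∧ w ∈ closure (W '' Metric.closedBall 0 1) ∧ (c : ℂ) • y = R z + w := by
  set M₁ := coordinates '' (R '' Metric.closedBall 0 1)
  set M₂ := coordinates '' closure (W '' Metric.closedBall 0 1)
  have hcl : IsClosed (M₁ + M₂) :=
    (hR.isCompact_coordinates.add hW.isCompact_coordinates).isClosed
  have hlin : IsLinearMap ℝ coordinates := (coordinates.restrictScalars ℝ).isLinear
  have hconv : Convex ℝ (M₁ + M₂) :=
    ((convex_image_closedBall R).is_linear_image hlin).add
      ((convex_image_closedBall W).closure.is_linear_image hlin)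
  suffices hmem : coordinates ((c : ℂ) • y) ∈ M₁ + M₂ by
    obtain ⟨_, ⟨_, ⟨z, hz, rfl⟩, rfl⟩, _, ⟨w, hw, rfl⟩, hsum⟩ := hmem
    refine ⟨z, w, by simpa using hz, hw, coordinates_injective ?_⟩
    rw [map_add]
    exact hsum.symm
  by_contra hcon
  obtain ⟨f, u, hfu, hfy⟩ := RCLike.geometric_hahn_banach_closed_point (𝕜 := ℂ) hconv hcl hcon
  -- The separating functional has finitely many coordinates, hence is pairing with some x in ℓ^1.
  -- Its real part has supremum at least ‖S x‖ + ‖W* x‖ on the sum of images, but is at most c‖x‖ at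
  -- c y.
  obtain ⟨I, hI⟩ := exists_finset_forall_dual_pi_eq_sum f
  set x : SeqOne := ∑ i ∈ I, lp.single 1 i (f (Pi.single i 1)) with hx
  have hfx : ∀ v : SeqInfty, f (coordinates v) = pairing x v := by
    intro v
    rw [hI, hx, map_sum, sum_apply]
    exact Finset.sum_congr rfl fun i _ => (pairing_single i _ v).symm
  obtain ⟨z, hz, hSz⟩ := exists_pairing_eq_norm (S x)
  have hlt : ∀ v, ‖v‖ ≤ 1 → ‖S x‖ + ((pairing x) (W v)).re < u := by
    intro v hv
    have := hfu (coordinates (R z) + coordinates (W v)) (Set.add_mem_add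
      (mem_image_of_mem _ (mem_image_of_mem _ (by simpa using hz)))
      (mem_image_of_mem _ (subset_closure (mem_image_of_mem _ (by simpa using hv)))))
    rw [map_add, hfx, hfx, hR.pairing_apply, hSz] at this
    simpa using this
  have h1 := norm_add_norm_le_of_forall_re_lt hlt
  rw [hfx, map_smul, smul_eq_mul] at hfy
  have h2 : RCLike.re ((c : ℂ) * pairing x y) ≤ c * ‖x‖ := by
    refine (RCLike.re_le_norm _).trans ?_
    rw [norm_mul, Complex.norm_real, Real.norm_of_nonneg hc]
    gcongr
    simpa using (pairing x).le_of_opNorm_le_of_le (norm_pairing_le x) hy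
  have h3 := h x
  linarith

theorem norm_apply_le_of_mem_closure {φ : StrongDual ℂ SeqInfty} {w : SeqInfty}
    (hw : w ∈ closure (W '' Metric.closedBall 0 1)) : ‖φ w‖ ≤ ‖φ.comp W‖ := by
  refine closure_minimal (t := {w | ‖φ w‖ ≤ ‖φ.comp W‖}) ?_
    (isClosed_le (by fun_prop) continuous_const) hw
  rintro _ ⟨v, hv, rfl⟩
  simpa using (φ.comp W).le_opNorm_of_le (show ‖v‖ ≤ 1 by simpa using hv)

/-- The ball of radius c lies in R(ball) plus the closure of W(ball), so φ can be estimated on the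
two summands separately. This extends the bound from ℓ^1 to the full dual. -/
theorem mul_norm_le_norm_comp_add (hR : IsAdjointOp S R) (hW : IsWeaklyCompactOp W) {c : ℝ}
    (hc : 0 < c) (h : ∀ x : SeqOne, c * ‖x‖ ≤ ‖S x‖ + ‖(pairing x).comp W‖)
    (φ : StrongDual ℂ SeqInfty) : c * ‖φ‖ ≤ ‖φ.comp R‖ + ‖φ.comp W‖ := by
  rw [← le_div_iff₀' hc]
  refine ContinuousLinearMap.opNorm_le_of_unit_norm (𝕜 := ℂ) (by positivity) fun y hy => ?_
  obtain ⟨z, w, hz, hw, hzw⟩ := exists_add_eq_smul hR hW hc.le h hy.le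
  rw [le_div_iff₀' hc]
  have h1 : c * ‖φ y‖ = ‖φ ((c : ℂ) • y)‖ := by
    rw [map_smul, norm_smul, Complex.norm_real, Real.norm_of_nonneg hc.le]
  rw [h1, hzw, map_add]
  refine (norm_add_le _ _).trans (add_le_add ?_ (norm_apply_le_of_mem_closure hw))
  simpa using (φ.comp R).le_opNorm_of_le hz

theorem exists_norm_sub_apply_lt {X : Type*} [NormedAddCommGroup X] [NormedSpace ℂ X]
    {T : X →L[ℂ] X} (hT : ∀ φ, dualOp T φ = 0 → φ = 0) (y : X) {δ : ℝ} (hδ : 0 < δ) :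
    ∃ z, ‖y - T z‖ < δ := by
  suffices hmem : y ∈ closure (range T) by
    obtain ⟨_, ⟨z, rfl⟩, hz⟩ := Metric.mem_closure_iff.1 hmem δ hδ
    exact ⟨z, by rwa [← dist_eq_norm]⟩
  by_contra hcon
  have hconv : Convex ℝ (closure (range T)) := by
    rw [← image_univ]
    exact (convex_univ.is_linear_image
      ((T.restrictScalars ℝ : X →L[ℝ] X) : X →ₗ[ℝ] X).isLinear).closure
  obtain ⟨f, u, hfu, hfy⟩ := RCLike.geometric_hahn_banach_closed_point (𝕜 := ℂ) hconv
    isClosed_closure hcon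
  have hf : f = 0 := hT f <| by
    refine ContinuousLinearMap.ext fun z => ?_
    by_contra hne
    rw [dualOp_apply] at hne
    have := hfu (T (((u : ℂ) / f (T z)) • z)) (subset_closure (mem_range_self _))
    rw [map_smul, map_smul, smul_eq_mul, div_mul_cancel₀ _ hne] at this
    simp at this
  have h0 := hfu 0 (subset_closure ⟨0, map_zero T⟩)
  rw [hf] at h0 hfy
  simp only [zero_apply, map_zero] at h0 hfy
  linarith

/-- Injectivity of T* gives T dense range; on the range φ n (T z) → 0, and boundedness of the φ n
extends this to every y. -/
theorem tendsto_apply_of_tendsto_norm_dualOp {X : Type*} [NormedAddCommGroup X] [NormedSpace ℂ X]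
    {T : X →L[ℂ] X} (hT : ∀ φ, dualOp T φ = 0 → φ = 0) {φ : ℕ → StrongDual ℂ X} {C : ℝ}
    (hC : ∀ n, ‖φ n‖ ≤ C) (h : Tendsto (fun n => ‖dualOp T (φ n)‖) atTop (𝓝 0)) (y : X) :
    Tendsto (fun n => φ n y) atTop (𝓝 0) := by
  have hC0 : 0 ≤ C := (norm_nonneg _).trans (hC 0)
  rw [Metric.tendsto_nhds]
  intro ε hε
  obtain ⟨z, hz⟩ := exists_norm_sub_apply_lt hT y (δ := ε / (2 * (C + 1))) (by positivity)
  have hlim : Tendsto (fun n => ‖dualOp T (φ n)‖ * ‖z‖) atTop (𝓝 0) := by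
    simpa using h.mul_const ‖z‖
  filter_upwards [hlim.eventually_lt_const (half_pos hε)] with n hn
  rw [dist_zero_right]
  have h1 : φ n y = φ n (y - T z) + dualOp T (φ n) z := by
    rw [dualOp_apply, map_sub, sub_add_cancel]
  have h2 : ‖φ n (y - T z)‖ ≤ ε / 2 := by
    calc _ ≤ ‖φ n‖ * ‖y - T z‖ := (φ n).le_opNorm _
      _ ≤ (C + 1) * (ε / (2 * (C + 1))) :=
        mul_le_mul ((hC n).trans (by linarith)) hz.le (norm_nonneg _) (by linarith)
      _ = ε / 2 := by field_simp
  have h3 := (dualOp T (φ n)).le_opNorm z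
  rw [h1]
  linarith [norm_add_le (φ n (y - T z)) (dualOp T (φ n) z)]

theorem dualOp_pairing (hR : IsAdjointOp S R) (x : SeqOne) :
    dualOp (R + W) (pairing x) = pairing (S x) + (pairing x).comp W := by
  ext y
  change pairing x (R y + W y) = pairing (S x) y + pairing x (W y)
  rw [map_add, hR.pairing_apply]

/-- On the summable sequences, `S` and `W*` are jointly bounded below if `(S* + W)*` is
injective. -/
theorem exists_pos_mul_norm_le (hR : IsAdjointOp S R)
    (hinj : ∀ φ, dualOp (R + W) φ = 0 → φ = 0) :
    ∃ c > 0, ∀ x : SeqOne, c * ‖x‖ ≤ ‖S x‖ + ‖(pairing x).comp W‖ := by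
  by_contra! hcon
  have hex : ∀ n : ℕ, ∃ x : SeqOne, ‖x‖ = 1 ∧ ‖S x‖ + ‖(pairing x).comp W‖ < 1 / ((n : ℝ) + 1) := by
    intro n
    obtain ⟨x, hx⟩ := hcon (1 / ((n : ℝ) + 1)) (by positivity)
    have hx0 : 0 < ‖x‖ := by
      refine norm_pos_iff.2 fun h => ?_
      rw [h] at hx
      simp at hx
    have hinv : ‖((‖x‖ : ℂ))⁻¹‖ = ‖x‖⁻¹ := by rw [norm_inv, Complex.norm_real, norm_norm]
    refine ⟨(‖x‖ : ℂ)⁻¹ • x, ?_, ?_⟩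
    · rw [norm_smul, hinv, inv_mul_cancel₀ hx0.ne']
    · have h1 : (pairing ((‖x‖ : ℂ)⁻¹ • x)).comp W = (‖x‖ : ℂ)⁻¹ • (pairing x).comp W := by
        rw [map_smul, ContinuousLinearMap.smul_comp]
      rw [h1, map_smul, norm_smul, norm_smul, hinv, ← mul_add, inv_mul_lt_iff₀ hx0, mul_comm]
      exact hx
  choose x hx1 hx using hex
  have hlim : Tendsto (fun n => ‖dualOp (R + W) (pairing (x n))‖) atTop (𝓝 0) := by
    refine squeeze_zero (fun _ => norm_nonneg _) (fun n => ?_) tendsto_one_div_add_atTop_nhds_zero_nat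
    rw [dualOp_pairing hR]
    exact (norm_add_le _ _).trans ((add_le_add_left (norm_pairing_le _) _).trans (hx n).le)
  -- By density of the range the unit vectors x n are weakly null in ℓ^1, which the Schur property
  -- forbids.
  exact not_forall_le_norm_of_weakly_null (fun n => (hx1 n).le)
    (tendsto_apply_of_tendsto_norm_dualOp hinj
      (fun n => (norm_pairing_le _).trans (hx1 n).le) hlim) one_pos fun n => (hx1 n).ge

/-- If `T = S* + W` has dense range, then `T*` is bounded below. -/
theorem injModulus_dualOp_pos {T : SeqInfty →L[ℂ] SeqInfty} (hT : T ∈ adjointPlusWeaklyCompact)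
    (hinj : ∀ φ, dualOp T φ = 0 → φ = 0) : 0 < injModulus (dualOp T) := by
  obtain ⟨S, R, W, hR, hW, rfl⟩ := hT
  obtain ⟨c, hc, hlow⟩ := exists_pos_mul_norm_le hR hinj
  refine lt_of_le_of_ne (injModulus_nonneg _) fun h0 => ?_
  -- As `sInf ∅ = 0`, minimising sequences need the unit sphere of the dual to be nonempty.
  have hne : ((fun φ => ‖dualOp (R + W) φ‖) '' {φ : StrongDual ℂ SeqInfty | ‖φ‖ = 1}).Nonempty := by
    obtain ⟨g, hg, -⟩ := exists_dual_vector ℂ (lp.single ∞ 0 1 : SeqInfty)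
      (by rw [lp.norm_single (by simp)]; simp)
    exact ⟨_, g, hg, rfl⟩
  have hex : ∀ n : ℕ, ∃ φ : StrongDual ℂ SeqInfty, ‖φ‖ = 1 ∧
      ‖dualOp (R + W) φ‖ < 1 / ((n : ℝ) + 1) := by
    intro n
    obtain ⟨_, ⟨φ, hφ, rfl⟩, hlt⟩ := exists_lt_of_csInf_lt hne
      (b := 1 / ((n : ℝ) + 1)) (h0.symm.trans_lt (by positivity))
    exact ⟨φ, hφ, hlt⟩
  choose φ hφ1 hφ using hex
  have hlim : Tendsto (fun n => ‖dualOp (R + W) (φ n)‖) atTop (𝓝 0) :=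
    squeeze_zero (fun _ => norm_nonneg _) (fun n => (hφ n).le) tendsto_one_div_add_atTop_nhds_zero_nat
  have hWlim := hW.tendsto_norm_comp (fun n => (hφ1 n).le)
    (tendsto_apply_of_tendsto_norm_dualOp hinj (fun n => (hφ1 n).le) hlim)
  have hbound : ∀ n, c ≤ ‖dualOp (R + W) (φ n)‖ + ‖(φ n).comp W‖ + ‖(φ n).comp W‖ := by
    intro n
    have h1 := mul_norm_le_norm_comp_add hR hW hc hlow (φ n)
    rw [hφ1, mul_one] at h1
    have h2 : (φ n).comp R = dualOp (R + W) (φ n) - (φ n).comp W := by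
      ext y
      change φ n (R y) = φ n (R y + W y) - φ n (W y)
      rw [map_add, add_sub_cancel_right]
    rw [h2] at h1
    exact h1.trans (add_le_add_left (norm_sub_le _ _) _)
  have := ge_of_tendsto' ((hlim.add hWlim).add hWlim) hbound
  simp only [add_zero] at this
  linarith

end AdjointPlusWeaklyCompact

end

theorem proposition3p4 (T : SeqInfty →L[ℂ] SeqInfty) (hT : T ∈ adjointPlusWeaklyCompact) :
    List.TFAE [
      IsJMixClass T,
      IsJClass T,
      ∃ x : SeqInfty, x ≠ 0 ∧ (interior (JSet T x)).Nonempty,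
      (spectrum ℂ T ∩ Metric.sphere (0 : ℂ) 1).Nonempty ∧
        pointSpectrum (dualOp T) ∩ Metric.closedBall (0 : ℂ) 1 = ∅,
      1 < injRadius (dualOp T) ∧ Metric.closedBall (0 : ℂ) 1 ⊆ pointSpectrum T,
      1 < injRadius (dualOp T) ∧ (0 : ℂ) ∈ pointSpectrum T] := by
  refine tfae_of_forall_injModulus_dualOp_pos T fun μ hμ => ?_
  rw [← dualOp_sub_smul]
  refine injModulus_dualOp_pos (sub_smul_mem_adjointPlusWeaklyCompact hT μ) fun φ hφ => ?_
  by_contra hne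
  refine hμ (mem_pointSpectrum_iff.2 ⟨φ, hne, ?_⟩)
  rw [dualOp_sub_smul, sub_apply, sub_eq_zero] at hφ
  exact hφ
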